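/- Let $h:\mathbb{R}\to\mathbb{R}$ be a $C^\infty$ function with $h(t)=\sum_{m\ge 0}h_m t^m$ for all $t\in\mathbb{R}$, where $h_m\ge 0$ for all $m$, and let $\tau\in\mathbb{R}$. Then there are positive constants $C_{1,n}, C_{2,n}$ $(n\in\mathbb{N}_0)$, depending only on $h$, $\tau$ and $n$, such that the following holds for every dimension $d$ and all $\sigma_1,\dots,\sigma_d>0$ with $\sigma_1+\dots+\sigma_d\le\tau$. Let $\Sigma=\mathrm{diag}(\sigma_1,\dots,\sigma_d)$, let $\mu=\mathcal{N}(0,\Sigma)$ on $\mathbb{R}^d$, and let $k(x,x')=h(\langle x,x'\rangle)$. Assume that $k$ has finite Hilbert–Schmidt norm, $\iint k(x,x')^2\,\mu(\mathrm{d}x)\,\mu(\mathrm{d}x')<\infty$ (which holds in particular if $k$ is trace-class), and let $Tf(x)=\int k(x,x')f(x')\,\mu(\mathrm{d}x')$ be its integral operator on $L^2(\mu)$. Then the eigenvalues of $T$, counted with multiplicity, can be indexed by the multi-indices, i.e. $L^2(\mu)$ has an orthonormal basis $(e_\beta)_{\beta\in\mathbb{Z}^d_{\ge 0}}$ with $Te_\beta=\lambda_\beta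 e_\beta$, in such a way that $$C_{1,|\beta|}\,\sigma_1^{\beta_1}\cdots\sigma_d^{\beta_d}\;\le\;\lambda_\beta\;\le\;C_{2,|\beta|}\,\sigma_1^{\beta_1}\cdots\sigma_d^{\beta_d},\qquad |\beta|=\beta_1+\dots+\beta_d,$$ for every $\beta\in\mathbb{Z}^d_{\ge 0}$ such that $h_m>0$ for all $m\le|\beta|$ with $m\equiv|\beta| \pmod 2$. In particular, if $h_m>0$ for all $m$, the bounds hold for every $\beta$, hence for every eigenvalue of $T$. -/

import Mathlib

open MeasureTheory ProbabilityTheory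
open scoped NNReal ENNReal ContDiff

noncomputable section

/-- The centred Gaussian measure on `ℝ^d` with covariance matrix `diag (σ₁, …, σ_d)`: the
coordinates are independent, the `i`-th one being `N(0, σ i)` (so `σ i` is a variance). -/
def diagGaussian {d : ℕ} (σ : Fin d → ℝ≥0) : Measure (Fin d → ℝ) :=
  Measure.pi fun i => gaussianReal 0 (σ i)

/-- The inner-product kernel `k(x, x') = h(⟨x, x'⟩)` on `ℝ^d`. -/
def innerProductKernel (h : ℝ → ℝ) (d : ℕ) (x x' : Fin d → ℝ) : ℝ :=
  h (∑ i, x i * x' i)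

/-- `h` is a smooth function with an everywhere convergent power series expansion
`h t = ∑ m, a m * t ^ m` whose coefficients are nonnegative. -/
structure IsNonnegSeries (h : ℝ → ℝ) (a : ℕ → ℝ) : Prop where
  contDiff : ContDiff ℝ ∞ h
  nonneg : ∀ m, 0 ≤ a m
  hasSum : ∀ t, HasSum (fun m => a m * t ^ m) (h t)

/-- The kernel `k` has finite Hilbert-Schmidt norm: `∫∫ k(x, x')² μ(dx) μ(dx') < ∞`. -/
def IsHilbertSchmidtKernel {X : Type*} [MeasurableSpace X] (k : X → X → ℝ) (μ : Measure X) :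
    Prop :=
  MemLp (fun p : X × X => k p.1 p.2) 2 (μ.prod μ)

/-- The integral operator of the kernel `k`: `(T f)(x) = ∫ k(x, x') f(x') μ(dx')`. -/
def integralOperator {X : Type*} [MeasurableSpace X] (k : X → X → ℝ) (μ : Measure X)
    (f : X → ℝ) : X → ℝ :=
  fun x => ∫ x', k x x' * f x' ∂μ

/-- `e` is an orthonormal basis (complete orthonormal system) of `L²(μ)` consisting of
eigenfunctions of the integral operator of `k`, with eigenvalues `lam`. Thus `lam` lists all the
eigenvalues of the operator, each with its multiplicity. -/
def IsEigenbasis {X ι : Type*} [MeasurableSpace X] (k : X → X → ℝ) (μ : Measure X)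
    (e : HilbertBasis ι ℝ (Lp ℝ 2 μ)) (lam : ι → ℝ) : Prop :=
  ∀ j, integralOperator k μ (e j) =ᵐ[μ] fun x => lam j * e j x

end

/-!
Expanding `h` turns the quadratic form of the integral operator into the diagonal form
`⟨T f, f⟩ = ∑ α, c α * ⟨x ^ α, f⟩ ^ 2`, where `c α` is `a |α|` times a multinomial coefficient.
Written in normalized Hermite polynomials `H β` of a fixed degree `n`, this form is at most
`K n * ∑ β, σ ^ β * x β ^ 2`, and `L n * ⟨T f, f⟩` dominates `∑ β, σ ^ β * ⟨H β, f⟩ ^ 2` as soon as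
the coefficients of degree at most `n` and of the parity of `n` are positive. For the upper bound to
be independent of `d` and `σ` one needs `a m * m ! ≤ M * r ^ m` with `r * σ i ≤ 3 / 5`; this is what
the finite Hilbert-Schmidt norm provides, through the even moments of a single coordinate.

A polynomial of degree `n` built from the `H β` with `σ ^ β` in a dyadic range is concentrated on
the eigenvectors whose eigenvalues are close to that range, so up to a small error it is spanned by
the eigenvectors with `θ n * σ ^ β ≤ lam ≤ (θ n)⁻¹ * σ ^ β` when `θ n` is small. Errors that are
summable over the degrees leave enough room for a dimension count, and Hall's marriage theorem
assigns distinct comparable eigenvalues to the multi-indices. Conversely the eigenvectors inject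
into the multi-indices: only degrees `n` of a single variable are needed, since `θ n ≤ 1 / n !` is
eventually smaller than any geometric sequence. The Schröder-Bernstein theorem combines the two
injections into a bijection.
-/

open Finset Filter Topology
open scoped InnerProductSpace

section SpectralTheorem

theorem exists_hilbertBasis_eigenvectors.{u, v} {𝕜 : Type u} {H : Type v} [RCLike 𝕜]
    [NormedAddCommGroup H] [InnerProductSpace 𝕜 H] [CompleteSpace H] {T : H →L[𝕜] H}
    (hT : IsCompactOperator T) (hT' : (T : H →ₗ[𝕜] H).IsSymmetric) :
    ∃ (J : Type (max u v)) (e : HilbertBasis J 𝕜 H) (lam : J → 𝕜), ∀ j, T (e j) = lam j • e j := by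
  let E (μ : 𝕜) : Submodule 𝕜 H := Module.End.eigenspace (T : Module.End 𝕜 H) μ
  have hE (μ : 𝕜) : CompleteSpace (E μ) := by
    have hclosed : IsClosed (E μ : Set H) := by
      have heq : (E μ : Set H) = {x | T x = μ • x} := Set.ext fun x => Module.End.mem_eigenspace_iff
      exact heq ▸ isClosed_eq T.continuous (continuous_const_smul μ)
    exact hclosed.completeSpace_coe
  choose w b _ using fun μ => exists_hilbertBasis 𝕜 (E μ)
  have horth : Orthonormal 𝕜 fun a : Σ μ, w μ => (b a.1 a.2 : H) :=
    hT'.orthogonalFamily_eigenspaces.orthonormal_sigma_orthonormal fun μ => (b μ).orthonormal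
  set V := Submodule.span 𝕜 (Set.range fun a : Σ μ, w μ => (b a.1 a.2 : H))
  have hE_le (μ : 𝕜) : E μ ≤ V.topologicalClosure := by
    intro y hy
    have hsum := ((b μ).hasSum_repr ⟨y, hy⟩).mapL (E μ).subtypeL
    refine mem_closure_of_tendsto hsum (.of_forall fun F => Submodule.sum_mem _ fun i _ => ?_)
    exact Submodule.smul_mem _ _ (Submodule.subset_span ⟨⟨μ, i⟩, rfl⟩)
  have htotal : Vᗮ = ⊥ := by
    rw [← Submodule.orthogonal_closure, eq_bot_iff,
      ← ContinuousLinearMap.orthogonalComplement_iSup_eigenspaces_eq_bot hT hT']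
    exact Submodule.orthogonal_le (iSup_le hE_le)
  refine ⟨Σ μ, w μ, .mkOfOrthogonalEqBot horth htotal, Sigma.fst, fun a => ?_⟩
  rw [HilbertBasis.coe_mkOfOrthogonalEqBot]
  exact Module.End.mem_eigenspace_iff.1 (b a.1 a.2).2

theorem finite_setOf_le_norm_eigenvalue {𝕜 H J : Type*} [RCLike 𝕜] [NormedAddCommGroup H]
    [InnerProductSpace 𝕜 H] {T : H →L[𝕜] H} (hT : IsCompactOperator T) {e : J → H}
    (he : Orthonormal 𝕜 e) {lam : J → 𝕜} (hlam : ∀ j, T (e j) = lam j • e j) {c : ℝ} (hc : 0 < c) :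
    {j | c ≤ ‖lam j‖}.Finite := by
  have hsep {i j : J} (hij : i ≠ j) : ‖lam i‖ ≤ ‖T (e i) - T (e j)‖ := by
    have hinner : ⟪e i, T (e i) - T (e j)⟫_𝕜 = lam i := by
      simp [inner_sub_right, hlam, inner_smul_right, he.2 hij, inner_self_eq_norm_sq_to_K, he.1]
    simpa [hinner, he.1] using norm_inner_le_norm (𝕜 := 𝕜) (e i) (T (e i) - T (e j))
  by_contra hinf
  obtain ⟨K, hK, hTK⟩ :=
    IsCompactOperator.image_closedBall_subset_compact (f := (T : H →ₗ[𝕜] H)) hT 1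
  let φ := Set.Infinite.natEmbedding _ hinf
  obtain ⟨_, -, ψ, hψ, hlim⟩ := hK.tendsto_subseq (x := fun n => T (e (φ n)))
    fun n => hTK ⟨e (φ n), by simp [he.1], rfl⟩
  obtain ⟨N, hN⟩ := Metric.cauchySeq_iff'.1 hlim.cauchySeq c hc
  have hne : (φ (ψ (N + 1)) : J) ≠ φ (ψ N) := fun h =>
    N.succ_ne_self (hψ.injective (φ.injective (Subtype.ext h)))
  have hlt := hN (N + 1) N.le_succ
  rw [dist_eq_norm] at hlt
  exact absurd hlt (not_lt.2 ((φ (ψ (N + 1))).2.trans (hsep hne)))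

end SpectralTheorem

section HallSelection

variable {H J S : Type*} [NormedAddCommGroup H] [InnerProductSpace ℝ H]

theorem exists_sum_smul_inner_eq_zero (e : J → H) (u : S → H) {A : Finset J} {B : Finset S}
    (hAB : #A < #B) :
    ∃ a : S → ℝ, (∃ β ∈ B, a β ≠ 0) ∧ ∀ j ∈ A, ⟪e j, ∑ β ∈ B, a β • u β⟫_ℝ = 0 := by
  have hdep : ¬ LinearIndepOn ℝ (fun β (j : A) => ⟪e j, u β⟫_ℝ) (B : Set S) := fun h => by
    have := LinearIndependent.fintype_card_le_finrank h
    simp at this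
    omega
  rw [linearIndepOn_finset_iff] at hdep
  push Not at hdep
  obtain ⟨a, ha, hne⟩ := hdep
  refine ⟨a, hne, fun j hj => ?_⟩
  simpa [inner_sum, inner_smul_right] using congrFun ha ⟨j, hj⟩

theorem norm_sq_sum_smul_of_orthonormal {u : S → H} (hu : Orthonormal ℝ u) (a : S → ℝ)
    (B : Finset S) : ‖∑ β ∈ B, a β • u β‖ ^ 2 = ∑ β ∈ B, a β ^ 2 := by
  rw [← real_inner_self_eq_norm_sq, hu.inner_sum]
  simp [sq]

/-- Otherwise Hall's condition fails on some `B`, and by a dimension count a nonzero combination of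
the `u β` with `β ∈ B` is orthogonal to all `e j` it is almost spanned by. -/
theorem exists_injective_mem_of_almost_spanned {ι : Type*} (e : J → H) {u : S → H}
    (hu : Orthonormal ℝ u) (γ : S → ι) {ε : ι → ℝ} (hε : ∀ g, 0 ≤ ε g)
    (hε_sum : ∀ G : Finset ι, ∑ g ∈ G, ε g < 1) (t : S → Finset J)
    (h : ∀ (g : ι) (B : Finset S), (∀ β ∈ B, γ β = g) → ∀ (a : S → ℝ) (x : H),
      (∀ β ∈ B, ∀ j ∈ t β, ⟪e j, x⟫_ℝ = 0) →
        ⟪x, ∑ β ∈ B, a β • u β⟫_ℝ ≤ ε g * (‖x‖ * ‖∑ β ∈ B, a β • u β‖)) :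
    ∃ f : S → J, Function.Injective f ∧ ∀ β, f β ∈ t β := by
  classical
  rw [← all_card_le_biUnion_card_iff_exists_injective]
  intro B
  by_contra! hlt
  obtain ⟨a, ⟨β₀, hβ₀, ha⟩, horth⟩ := exists_sum_smul_inner_eq_zero e u hlt
  set v := ∑ β ∈ B, a β • u β
  have hvpos : 0 < ‖v‖ ^ 2 := by
    rw [norm_sq_sum_smul_of_orthonormal hu]
    exact sum_pos' (fun _ _ => sq_nonneg _) ⟨β₀, hβ₀, by positivity⟩
  have hle (g : ι) : ‖∑ β ∈ B with γ β = g, a β • u β‖ ≤ ‖v‖ := by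
    refine (sq_le_sq₀ (norm_nonneg _) (norm_nonneg _)).1 ?_
    simp only [v, norm_sq_sum_smul_of_orthonormal hu]
    exact sum_le_sum_of_subset_of_nonneg (filter_subset _ _) fun _ _ _ => sq_nonneg _
  have hfiber (g : ι) : ⟪v, ∑ β ∈ B with γ β = g, a β • u β⟫_ℝ ≤ ε g * ‖v‖ ^ 2 := by
    refine (h g _ (by simp) a v fun β hβ j hj => ?_).trans ?_
    · exact horth j (mem_biUnion.2 ⟨β, (mem_filter.1 hβ).1, hj⟩)
    · rw [sq]
      exact mul_le_mul_of_nonneg_left (mul_le_mul_of_nonneg_left (hle g) (norm_nonneg v)) (hε g)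
  have hsplit : ∑ g ∈ B.image γ, ∑ β ∈ B with γ β = g, a β • u β = v :=
    sum_fiberwise_of_maps_to (fun β hβ => mem_image_of_mem γ hβ) _
  have hcontra : ‖v‖ ^ 2 < ‖v‖ ^ 2 :=
    calc ‖v‖ ^ 2 = ∑ g ∈ B.image γ, ⟪v, ∑ β ∈ B with γ β = g, a β • u β⟫_ℝ := by
          rw [← inner_sum, hsplit, real_inner_self_eq_norm_sq]
      _ ≤ ∑ g ∈ B.image γ, ε g * ‖v‖ ^ 2 := sum_le_sum fun g _ => hfiber g
      _ < ‖v‖ ^ 2 := by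
          rw [← sum_mul]
          exact mul_lt_of_lt_one_left hvpos (hε_sum _)
  exact hcontra.false

theorem inner_le_of_sum_inner_sq_le (e : HilbertBasis J ℝ H) {A : Finset J} {x y : H} {c : ℝ}
    (hc : 0 ≤ c) (hx : ∀ j ∈ A, ⟪e j, x⟫_ℝ = 0)
    (hy : ∀ F : Finset J, Disjoint F A → ∑ j ∈ F, ⟪e j, y⟫_ℝ ^ 2 ≤ c ^ 2) :
    ⟪x, y⟫_ℝ ≤ ‖x‖ * c := by
  classical
  refine hasSum_le_of_sum_le (e.hasSum_inner_mul_inner x y) fun F => ?_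
  have hbessel : ∑ j ∈ F \ A, ⟪e j, x⟫_ℝ ^ 2 ≤ ‖x‖ ^ 2 := by
    simpa using e.orthonormal.sum_inner_products_le x (s := F \ A)
  calc ∑ j ∈ F, ⟪x, e j⟫_ℝ * ⟪e j, y⟫_ℝ = ∑ j ∈ F \ A, ⟪e j, x⟫_ℝ * ⟪e j, y⟫_ℝ := by
        simp_rw [real_inner_comm (e _) x]
        refine (sum_subset sdiff_subset fun j hj hj' => ?_).symm
        rw [hx j (by simpa [hj] using hj'), zero_mul]
    _ ≤ √(∑ j ∈ F \ A, ⟪e j, x⟫_ℝ ^ 2) * √(∑ j ∈ F \ A, ⟪e j, y⟫_ℝ ^ 2) :=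
        Real.sum_mul_le_sqrt_mul_sqrt _ _ _
    _ ≤ ‖x‖ * c := by
        gcongr
        · exact Real.sqrt_le_iff.2 ⟨norm_nonneg x, hbessel⟩
        · exact Real.sqrt_le_iff.2 ⟨hc, hy _ sdiff_disjoint⟩

end HallSelection

section FormComparison

/-- The numbers `x` and `y` agree up to the factor `θ` in both directions. -/
def IsComparable (θ x y : ℝ) : Prop :=
  θ * x ≤ y ∧ θ * y ≤ x

theorem sum_zpow_le {b M : ℝ} (hb : 1 < b) (hM : 0 ≤ M) {A : Finset ℤ} (h : ∀ k ∈ A, b ^ k ≤ M) :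
    ∑ k ∈ A, b ^ k ≤ (1 - b⁻¹)⁻¹ * M := by
  have hb0 : 0 < b := by linarith
  have hb1 : b⁻¹ < 1 := inv_lt_one_of_one_lt₀ hb
  rcases A.eq_empty_or_nonempty with rfl | hA
  · simpa using mul_nonneg (inv_nonneg.2 (sub_nonneg.2 hb1.le)) hM
  have hinj : Set.InjOn (fun k => (A.max' hA - k).toNat) A := fun i hi j hj hij => by
    have := A.le_max' i hi
    have := A.le_max' j hj
    simp only at hij
    omega
  calc ∑ k ∈ A, b ^ k = ∑ k ∈ A, b⁻¹ ^ (A.max' hA - k).toNat * b ^ A.max' hA := by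
        refine sum_congr rfl fun k hk => ?_
        have hk' : ((A.max' hA - k).toNat : ℤ) = A.max' hA - k :=
          Int.toNat_of_nonneg (sub_nonneg.2 (A.le_max' k hk))
        rw [inv_pow, ← zpow_natCast, hk', ← zpow_neg, ← zpow_add₀ hb0.ne']
        congr 1
        ring
    _ = (∑ n ∈ A.image fun k => (A.max' hA - k).toNat, b⁻¹ ^ n) * b ^ A.max' hA := by
        rw [sum_image hinj, sum_mul]
    _ ≤ (1 - b⁻¹)⁻¹ * M := by
        gcongr
        · exact sum_le_hasSum _ (fun n _ => by positivity)
            (hasSum_geometric_of_lt_one (by positivity) hb1)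
        · exact h _ (A.max'_mem hA)

theorem sum_inv_zpow_le {b M : ℝ} (hb : 1 < b) (hM : 0 ≤ M) {A : Finset ℤ}
    (h : ∀ k ∈ A, (b ^ k)⁻¹ ≤ M) : ∑ k ∈ A, (b ^ k)⁻¹ ≤ (1 - b⁻¹)⁻¹ * M := by
  have hneg : ∑ k ∈ A.map (Equiv.neg ℤ).toEmbedding, b ^ k = ∑ k ∈ A, (b ^ k)⁻¹ := by simp
  rw [← hneg]
  refine sum_zpow_le hb hM fun k hk => ?_
  obtain ⟨l, hl, rfl⟩ := mem_map.1 hk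
  simpa using h l hl

theorem sum_inv_add_inv_le {lam θ : ℝ} (hlam : 0 < lam) (hθ : 0 < θ) {A : Finset ℤ}
    (hA : ∀ k ∈ A, lam < θ * 2 ^ (k + 1) ∨ 2 ^ k < θ * lam) :
    ∑ k ∈ A, (lam * (2 ^ k)⁻¹ + 2 ^ k * lam⁻¹)⁻¹ ≤ 6 * θ := by
  classical
  have hlow : ∑ k ∈ A with lam < θ * 2 ^ (k + 1), ((2 : ℝ) ^ k)⁻¹ ≤ 2 * (2 * θ / lam) := by
    have hmem : ∀ k ∈ A.filter fun k => lam < θ * 2 ^ (k + 1), ((2 : ℝ) ^ k)⁻¹ ≤ 2 * θ / lam := by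
      intro k hk
      have hk := (mem_filter.1 hk).2
      rw [zpow_add_one₀ two_ne_zero] at hk
      rw [inv_le_iff_one_le_mul₀ (by positivity), div_mul_eq_mul_div, one_le_div hlam]
      linarith
    exact (sum_inv_zpow_le one_lt_two (by positivity) hmem).trans_eq (by norm_num)
  have hhigh : ∑ k ∈ A with ¬ lam < θ * 2 ^ (k + 1), (2 : ℝ) ^ k ≤ 2 * (θ * lam) := by
    have hmem : ∀ k ∈ A.filter fun k => ¬ lam < θ * 2 ^ (k + 1), (2 : ℝ) ^ k ≤ θ * lam :=
      fun k hk => ((hA k (mem_filter.1 hk).1).resolve_left (mem_filter.1 hk).2).le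
    exact (sum_zpow_le one_lt_two (by positivity) hmem).trans_eq (by norm_num)
  calc ∑ k ∈ A, (lam * (2 ^ k)⁻¹ + 2 ^ k * lam⁻¹)⁻¹
      ≤ ∑ k ∈ A with lam < θ * 2 ^ (k + 1), lam * ((2 : ℝ) ^ k)⁻¹ +
        ∑ k ∈ A with ¬ lam < θ * 2 ^ (k + 1), lam⁻¹ * (2 : ℝ) ^ k := by
        rw [← sum_filter_add_sum_filter_not A fun k => lam < θ * 2 ^ (k + 1)]
        gcongr with k _ k _
        · calc (lam * (2 ^ k)⁻¹ + 2 ^ k * lam⁻¹)⁻¹ ≤ (2 ^ k * lam⁻¹)⁻¹ := by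
                gcongr
                exact le_add_of_nonneg_left (by positivity)
            _ = lam * (2 ^ k)⁻¹ := by rw [mul_inv, inv_inv, mul_comm]
        · calc (lam * (2 ^ k)⁻¹ + 2 ^ k * lam⁻¹)⁻¹ ≤ (lam * (2 ^ k)⁻¹)⁻¹ := by
                gcongr
                exact le_add_of_nonneg_right (by positivity)
            _ = lam⁻¹ * 2 ^ k := by rw [mul_inv, inv_inv]
    _ ≤ lam * (2 * (2 * θ / lam)) + lam⁻¹ * (2 * (θ * lam)) := by
        rw [← mul_sum, ← mul_sum]
        gcongr
    _ = 6 * θ := by field_simp; ring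

theorem sq_sum_le_of_gap {lam θ : ℝ} (hlam : 0 < lam) (hθ : 0 < θ) {A : Finset ℤ}
    (hA : ∀ k ∈ A, lam < θ * 2 ^ (k + 1) ∨ 2 ^ k < θ * lam) (y : ℤ → ℝ) :
    (∑ k ∈ A, y k) ^ 2 ≤ 6 * θ * ∑ k ∈ A, (lam * (2 ^ k)⁻¹ + 2 ^ k * lam⁻¹) * y k ^ 2 :=
  calc (∑ k ∈ A, y k) ^ 2 ≤ (∑ k ∈ A, (lam * (2 ^ k)⁻¹ + 2 ^ k * lam⁻¹)⁻¹) *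
        ∑ k ∈ A, (lam * (2 ^ k)⁻¹ + 2 ^ k * lam⁻¹) * y k ^ 2 :=
        sum_sq_le_sum_mul_sum_of_sq_le_mul A (fun _ _ => by positivity) (fun _ _ => by positivity)
          fun k _ => (inv_mul_cancel_left₀ (by positivity) _).ge
    _ ≤ _ := by
        gcongr
        exact sum_inv_add_inv_le hlam hθ hA

variable {H J S : Type*} [NormedAddCommGroup H] [InnerProductSpace ℝ H]
  {T : H →L[ℝ] H} {e : HilbertBasis J ℝ H} {lam : J → ℝ}

theorem hasSum_eigenvalue_mul_inner_sq (hlam : ∀ j, T (e j) = lam j • e j) (v : H) :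
    HasSum (fun j => lam j * ⟪e j, v⟫_ℝ ^ 2) ⟪T v, v⟫_ℝ := by
  have hsum := ((e.hasSum_repr v).mapL T).mapL (innerSL ℝ v)
  rw [innerSL_apply_apply, real_inner_comm] at hsum
  refine hsum.congr_fun fun j => ?_
  simp only [HilbertBasis.repr_apply_apply, map_smul, hlam, innerSL_apply_apply,
    real_inner_comm v, smul_eq_mul]
  rw [real_inner_comm]
  ring

theorem sum_eigenvalue_mul_inner_sq_le (hlam : ∀ j, T (e j) = lam j • e j) (h0 : ∀ j, 0 ≤ lam j)
    (v : H) (F : Finset J) : ∑ j ∈ F, lam j * ⟪e j, v⟫_ℝ ^ 2 ≤ ⟪T v, v⟫_ℝ :=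
  sum_le_hasSum F (fun j _ => mul_nonneg (h0 j) (sq_nonneg _))
    (hasSum_eigenvalue_mul_inner_sq hlam v)

/-- The form of `T` is comparable, on the span of the vectors `u β` with `β ∈ P`, to the form that
is diagonal in the `u β` with entries `w β`: it is at most `K` times the diagonal form, and at
least `L⁻¹` times it. The lower bound is stated in the dual form, for all vectors of `H`. -/
structure IsFormComparable (T : H →L[ℝ] H) (u : S → H) (w : S → ℝ) (P : Set S) (K L : ℝ) :
    Prop where
  upper_nonneg : 0 ≤ K
  lower_nonneg : 0 ≤ L
  upper : ∀ (B : Finset S) (a : S → ℝ), ↑B ⊆ P →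
    ⟪T (∑ β ∈ B, a β • u β), ∑ β ∈ B, a β • u β⟫_ℝ ≤ K * ∑ β ∈ B, w β * a β ^ 2
  lower : ∀ (B : Finset S) (f : H), ↑B ⊆ P →
    ∑ β ∈ B, w β * ⟪u β, f⟫_ℝ ^ 2 ≤ L * ⟪T f, f⟫_ℝ

variable {u : S → H} {w : S → ℝ} {P : Set S} {K L : ℝ}

theorem IsFormComparable.inner_eq_zero (hT : IsFormComparable T u w P K L) {β : S} (hβ : β ∈ P)
    (hw : 0 < w β) {f : H} (hf : T f = 0) : ⟪u β, f⟫_ℝ = 0 := by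
  have h := hT.lower {β} f (by simpa using hβ)
  rw [sum_singleton, hf, inner_zero_left, mul_zero] at h
  exact pow_eq_zero_iff two_ne_zero |>.1 ((nonpos_of_mul_nonpos_right h hw).antisymm (sq_nonneg _))

/-- The lower form bound, tested on `f = ∑ j ∈ F, (lam j)⁻¹ • ⟪e j, v⟫ • e j`, bounds the inverse
form of `T`. -/
theorem IsFormComparable.sum_inv_eigenvalue_mul_inner_sq_le (hT : IsFormComparable T u w P K L)
    (hlam : ∀ j, T (e j) = lam j • e j) (h0 : ∀ j, 0 ≤ lam j) (hw : ∀ β, 0 < w β) {B : Finset S}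
    (hB : ↑B ⊆ P) (a : S → ℝ) (F : Finset J) :
    ∑ j ∈ F, (lam j)⁻¹ * ⟪e j, ∑ β ∈ B, a β • u β⟫_ℝ ^ 2 ≤ L * ∑ β ∈ B, (w β)⁻¹ * a β ^ 2 := by
  set v := ∑ β ∈ B, a β • u β
  set f := ∑ j ∈ F, ((lam j)⁻¹ * ⟪e j, v⟫_ℝ) • e j
  set X := ∑ j ∈ F, (lam j)⁻¹ * ⟪e j, v⟫_ℝ ^ 2 with hX
  set A := ∑ β ∈ B, (w β)⁻¹ * a β ^ 2
  have hX0 : 0 ≤ X := sum_nonneg fun j _ => mul_nonneg (inv_nonneg.2 (h0 j)) (sq_nonneg _)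
  have hA0 : 0 ≤ A := sum_nonneg fun β _ => mul_nonneg (inv_nonneg.2 (hw β).le) (sq_nonneg _)
  have hTf : ⟪T f, f⟫_ℝ = X := by
    simp only [f, map_sum, map_smul, hlam, smul_smul, e.orthonormal.inner_sum, hX, conj_trivial]
    refine sum_congr rfl fun j _ => ?_
    rcases eq_or_ne (lam j) 0 with h | h
    · simp [h]
    · field_simp
  have hvf : ∑ β ∈ B, a β * ⟪u β, f⟫_ℝ = X :=
    calc ∑ β ∈ B, a β * ⟪u β, f⟫_ℝ = ⟪v, f⟫_ℝ := by simp only [v, sum_inner, real_inner_smul_left]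
      _ = X := by
          simp only [f, inner_sum, inner_smul_right, hX]
          exact sum_congr rfl fun j _ => by rw [real_inner_comm (e j) v]; ring
  have hcs : X ^ 2 ≤ A * ∑ β ∈ B, w β * ⟪u β, f⟫_ℝ ^ 2 := by
    rw [← hvf]
    refine sum_sq_le_sum_mul_sum_of_sq_le_mul B
      (fun β _ => mul_nonneg (inv_nonneg.2 (hw β).le) (sq_nonneg _))
      (fun β _ => mul_nonneg (hw β).le (sq_nonneg _)) fun β _ => le_of_eq ?_
    field_simp [(hw β).ne']
  have hXX : X * X ≤ (L * A) * X := by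
    calc X * X ≤ A * (L * X) := by
          rw [← sq, ← hTf]
          exact hTf ▸ hcs.trans (mul_le_mul_of_nonneg_left (hTf ▸ hT.lower B f hB) hA0)
      _ = (L * A) * X := by ring
  rcases hX0.eq_or_lt with h | h
  · exact h ▸ mul_nonneg hT.lower_nonneg hA0
  · exact le_of_mul_le_mul_right hXX h

theorem IsFormComparable.block_le (hT : IsFormComparable T u w P K L)
    (hlam : ∀ j, T (e j) = lam j • e j) (h0 : ∀ j, 0 ≤ lam j) (hw : ∀ β, 0 < w β) {B : Finset S}
    (hB : ↑B ⊆ P) {M : ℝ} (hM : 0 < M) (hwM : ∀ β ∈ B, M ≤ w β ∧ w β ≤ 2 * M) (a : S → ℝ)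
    (F : Finset J) :
    ∑ j ∈ F, (lam j * M⁻¹ + M * (lam j)⁻¹) * ⟪e j, ∑ β ∈ B, a β • u β⟫_ℝ ^ 2
      ≤ (2 * K + L) * ∑ β ∈ B, a β ^ 2 := by
  set v := ∑ β ∈ B, a β • u β
  have hK := hT.upper_nonneg
  have hL := hT.lower_nonneg
  have hform : ∑ j ∈ F, lam j * ⟪e j, v⟫_ℝ ^ 2 ≤ K * (2 * M * ∑ β ∈ B, a β ^ 2) := by
    refine (sum_eigenvalue_mul_inner_sq_le hlam h0 v F).trans ((hT.upper B a hB).trans ?_)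
    refine mul_le_mul_of_nonneg_left ?_ hK
    rw [mul_sum]
    gcongr with β hβ
    exact (hwM β hβ).2
  have hform_inv : ∑ j ∈ F, (lam j)⁻¹ * ⟪e j, v⟫_ℝ ^ 2 ≤ L * (M⁻¹ * ∑ β ∈ B, a β ^ 2) := by
    refine (hT.sum_inv_eigenvalue_mul_inner_sq_le hlam h0 hw hB a F).trans ?_
    refine mul_le_mul_of_nonneg_left ?_ hL
    rw [mul_sum]
    gcongr with β hβ
    exact (hwM β hβ).1
  calc ∑ j ∈ F, (lam j * M⁻¹ + M * (lam j)⁻¹) * ⟪e j, v⟫_ℝ ^ 2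
      = M⁻¹ * ∑ j ∈ F, lam j * ⟪e j, v⟫_ℝ ^ 2 + M * ∑ j ∈ F, (lam j)⁻¹ * ⟪e j, v⟫_ℝ ^ 2 := by
        rw [mul_sum, mul_sum, ← sum_add_distrib]
        exact sum_congr rfl fun j _ => by ring
    _ ≤ M⁻¹ * (K * (2 * M * ∑ β ∈ B, a β ^ 2)) + M * (L * (M⁻¹ * ∑ β ∈ B, a β ^ 2)) := by gcongr
    _ = (2 * K + L) * ∑ β ∈ B, a β ^ 2 := by field_simp

/-- The vectors are split into dyadic blocks according to their weights; a gap between `lam j` and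
all the weights makes the weights in the Cauchy-Schwarz inequality over the blocks decay
geometrically. -/
theorem IsFormComparable.sum_inner_sq_le (hT : IsFormComparable T u w P K L)
    (hlam : ∀ j, T (e j) = lam j • e j) (h0 : ∀ j, 0 ≤ lam j) (hw : ∀ β, 0 < w β) {θ : ℝ}
    (hθ : 0 < θ) {B : Finset S} (hB : ↑B ⊆ P) (a : S → ℝ) {F : Finset J}
    (hF : ∀ j ∈ F, ∀ β ∈ B, ¬ IsComparable θ (w β) (lam j)) :
    ∑ j ∈ F, ⟪e j, ∑ β ∈ B, a β • u β⟫_ℝ ^ 2 ≤ 6 * θ * (2 * K + L) * ∑ β ∈ B, a β ^ 2 := by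
  let κ (β : S) : ℤ := Int.log 2 (w β)
  have hκ (β : S) : (2 : ℝ) ^ κ β ≤ w β := mod_cast Int.zpow_log_le_self one_lt_two (hw β)
  have hκ' (β : S) : w β < 2 ^ (κ β + 1) := mod_cast Int.lt_zpow_succ_log_self one_lt_two (w β)
  let V (k : ℤ) : H := ∑ β ∈ B with κ β = k, a β • u β
  have hV : ∑ β ∈ B, a β • u β = ∑ k ∈ B.image κ, V k :=
    (sum_fiberwise_of_maps_to (fun β hβ => mem_image_of_mem κ hβ) _).symm
  have hcs : ∀ j ∈ F, ⟪e j, ∑ β ∈ B, a β • u β⟫_ℝ ^ 2 ≤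
      6 * θ * ∑ k ∈ B.image κ, (lam j * (2 ^ k)⁻¹ + 2 ^ k * (lam j)⁻¹) * ⟪e j, V k⟫_ℝ ^ 2 := by
    intro j hj
    rcases (h0 j).eq_or_lt with hj0 | hj0
    · have horth : ∀ β ∈ B, ⟪e j, u β⟫_ℝ = 0 := fun β hβ => by
        rw [real_inner_comm]
        exact hT.inner_eq_zero (hB hβ) (hw β) (by rw [hlam, ← hj0, zero_smul])
      rw [inner_sum, sum_eq_zero fun β hβ => by rw [inner_smul_right, horth β hβ, mul_zero], ← hj0]
      simp
    · rw [hV, inner_sum]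
      refine sq_sum_le_of_gap hj0 hθ (forall_mem_image.2 fun β hβ => ?_) _
      have hgap := not_and_or.1 (hF j hj β hβ)
      simp only [not_le] at hgap
      refine hgap.imp (fun h => h.trans ?_) (hκ β).trans_lt
      exact mul_lt_mul_of_pos_left (hκ' β) hθ
  have hblock (k : ℤ) : ∑ j ∈ F, (lam j * (2 ^ k)⁻¹ + 2 ^ k * (lam j)⁻¹) * ⟪e j, V k⟫_ℝ ^ 2 ≤
      (2 * K + L) * ∑ β ∈ B with κ β = k, a β ^ 2 := by
    refine hT.block_le hlam h0 hw (fun β hβ => hB (mem_filter.1 hβ).1) (by positivity)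
      (fun β hβ => ?_) a F
    rw [← (mem_filter.1 hβ).2, ← zpow_one_add₀ two_ne_zero, add_comm]
    exact ⟨hκ β, (hκ' β).le⟩
  calc ∑ j ∈ F, ⟪e j, ∑ β ∈ B, a β • u β⟫_ℝ ^ 2
      ≤ 6 * θ * ∑ k ∈ B.image κ,
        ∑ j ∈ F, (lam j * (2 ^ k)⁻¹ + 2 ^ k * (lam j)⁻¹) * ⟪e j, V k⟫_ℝ ^ 2 := by
        rw [sum_comm, mul_sum]
        exact sum_le_sum hcs
    _ ≤ 6 * θ * ∑ k ∈ B.image κ, (2 * K + L) * ∑ β ∈ B with κ β = k, a β ^ 2 := by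
        gcongr with k
        exact hblock k
    _ = 6 * θ * (2 * K + L) * ∑ β ∈ B, a β ^ 2 := by
        rw [← mul_sum, sum_fiberwise_of_maps_to (fun β hβ => mem_image_of_mem κ hβ)]
        ring

theorem IsFormComparable.inner_le (hT : IsFormComparable T u w P K L)
    (hlam : ∀ j, T (e j) = lam j • e j) (h0 : ∀ j, 0 ≤ lam j) (hw : ∀ β, 0 < w β)
    (hu : Orthonormal ℝ u) {θ c : ℝ} (hθ : 0 < θ) (hc : 0 ≤ c) (hθc : 6 * θ * (2 * K + L) ≤ c ^ 2)
    {B : Finset S} (hB : ↑B ⊆ P) (a : S → ℝ) {t : Finset J} {x : H}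
    (ht : ∀ j, ∀ β ∈ B, IsComparable θ (w β) (lam j) → j ∈ t)
    (hx : ∀ j ∈ t, ⟪e j, x⟫_ℝ = 0) :
    ⟪x, ∑ β ∈ B, a β • u β⟫_ℝ ≤ c * (‖x‖ * ‖∑ β ∈ B, a β • u β‖) := by
  refine (inner_le_of_sum_inner_sq_le e (mul_nonneg hc (norm_nonneg _)) hx
    fun F hF => ?_).trans_eq (mul_left_comm _ _ _)
  refine (hT.sum_inner_sq_le hlam h0 hw hθ hB a fun j hj β hβ h => ?_).trans ?_
  · exact disjoint_left.1 hF hj (ht j β hβ h)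
  rw [mul_pow, norm_sq_sum_smul_of_orthonormal hu]
  gcongr

end FormComparison

section Matching

theorem eventually_isComparable_pow {θ : ℕ → ℝ} (hθ : ∀ n, θ n ≤ (n.factorial : ℝ)⁻¹) {x y : ℝ}
    (hx : 0 < x) (hy : 0 < y) : ∀ᶠ n in atTop, IsComparable (θ n) (x ^ n) y := by
  filter_upwards [(FloorSemiring.tendsto_pow_div_factorial_atTop x).eventually (ge_mem_nhds hy),
    (FloorSemiring.tendsto_pow_div_factorial_atTop x⁻¹).eventually (ge_mem_nhds (inv_pos.2 hy))]
    with n hn hn'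
  constructor
  · calc θ n * x ^ n ≤ (n.factorial : ℝ)⁻¹ * x ^ n := by gcongr; exact hθ n
      _ = x ^ n / n.factorial := (div_eq_inv_mul _ _).symm
      _ ≤ y := hn
  · calc θ n * y ≤ (n.factorial : ℝ)⁻¹ * y := by gcongr; exact hθ n
      _ = (x⁻¹ ^ n / n.factorial) * (x ^ n * y) := by rw [inv_pow]; field_simp
      _ ≤ y⁻¹ * (x ^ n * y) := by gcongr
      _ = x ^ n := by field_simp

theorem exists_injective_of_forall_frequently {J : Type*} [Countable J] {P : J → ℕ → Prop}
    (hP : ∀ j, ∃ᶠ n in atTop, P j n) : ∃ m : J → ℕ, Function.Injective m ∧ ∀ j, P j (m j) := by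
  obtain ⟨enc, henc⟩ := exists_injective_nat J
  obtain ⟨φ, hφ, hPφ⟩ := extraction_forall_of_frequently
    (P := fun k n => ∀ j, enc j = k → P j n) fun k => by
      by_cases hk : ∃ j, enc j = k
      · obtain ⟨j, rfl⟩ := hk
        exact (hP j).mono fun n hn j' hj' => henc hj' ▸ hn
      · exact .of_forall fun n j hj => absurd ⟨j, hj⟩ hk
  exact ⟨φ ∘ enc, hφ.injective.comp henc, fun j => hPφ _ j rfl⟩

/-- Multi-indices of large degree in one variable are used: there the slack `(n !)⁻¹` beats the
geometric growth or decay of the weights. -/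
theorem exists_injective_multiIndex_comparable {ι J : Type*} [Fintype ι] [Nonempty ι] [Countable J]
    {lam : J → ℝ} {σ : ι → ℝ} (hσ : ∀ i, 0 < σ i) {good : ℕ → Prop}
    (hgood : (∃ᶠ n in atTop, ¬ good n) ∨ ∀ j, 0 < lam j) {θ : ℕ → ℝ}
    (hθ : ∀ n, θ n ≤ (n.factorial : ℝ)⁻¹) :
    ∃ g : J → ι → ℕ, Function.Injective g ∧ ∀ j, good (∑ i, g j i) →
      IsComparable (θ (∑ i, g j i)) (∏ i, σ i ^ g j i) (lam j) := by
  classical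
  obtain ⟨i₀⟩ := ‹Nonempty ι›
  obtain ⟨m, hm, hm'⟩ := exists_injective_of_forall_frequently
    (P := fun j n => good n → IsComparable (θ n) (σ i₀ ^ n) (lam j)) fun j => by
      rcases hgood with hbad | hpos
      · exact hbad.mono fun n hn hn' => absurd hn' hn
      · exact (eventually_isComparable_pow hθ (hσ i₀) (hpos j)).frequently.mono fun n hn _ => hn
  refine ⟨fun j => Pi.single i₀ (m j), (Pi.single_injective i₀).comp hm, fun j => ?_⟩
  have hprod : ∏ i, σ i ^ (Pi.single i₀ (m j) : ι → ℕ) i = σ i₀ ^ m j := by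
    rw [prod_eq_single i₀ (fun i _ hi => by simp [hi]) (by simp), Pi.single_eq_same]
  rw [sum_pi_single', if_pos (mem_univ _), hprod]
  exact hm' j

variable {H J S : Type*} [NormedAddCommGroup H] [InnerProductSpace ℝ H]

theorem exists_finset_sum_inner_sq_le (e : HilbertBasis J ℝ H) (x : H) {c : ℝ} (hc : 0 < c) :
    ∃ t : Finset J, ∀ F : Finset J, Disjoint F t → ∑ j ∈ F, ⟪e j, x⟫_ℝ ^ 2 ≤ c := by
  obtain ⟨t, ht⟩ := summable_iff_vanishing_norm.1 (e.summable_inner_mul_inner x x) c hc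
  refine ⟨t, fun F hF => ((le_abs_self _).trans (ht F hF).le).trans' (le_of_eq ?_)⟩
  exact sum_congr rfl fun j _ => by rw [real_inner_comm, sq]

theorem sum_half_pow_add_two_lt_one (G : Finset ℕ) : ∑ g ∈ G, (1 / 2 : ℝ) ^ (g + 2) < 1 := by
  simp_rw [pow_add, ← sum_mul]
  have := sum_le_hasSum G (fun g _ => by positivity) hasSum_geometric_two
  linarith

/-- The vectors `u β` of a good degree form one group per degree; each of the remaining ones forms
a group of its own and only has to be almost spanned by finitely many eigenvectors. -/
theorem exists_injective_eigenvalue_comparable [Countable S] {T : H →L[ℝ] H}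
    {e : HilbertBasis J ℝ H} {lam : J → ℝ} (hlam : ∀ j, T (e j) = lam j • e j)
    (h0 : ∀ j, 0 ≤ lam j) (hfin : ∀ c > 0, {j | c ≤ lam j}.Finite) {u : S → H}
    (hu : Orthonormal ℝ u) {w : S → ℝ} (hw : ∀ β, 0 < w β) (deg : S → ℕ) {good : ℕ → Prop}
    {K L θ : ℕ → ℝ} (hθ : ∀ n, 0 < θ n)
    (hθKL : ∀ n, 6 * θ n * (2 * K n + L n) ≤ ((1 / 2) ^ (2 * n + 2)) ^ 2)
    (hform : ∀ n, good n → IsFormComparable T u w {β | deg β = n} (K n) (L n)) :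
    ∃ f : S → J, Function.Injective f ∧ ∀ β, good (deg β) →
      IsComparable (θ (deg β)) (w β) (lam (f β)) := by
  classical
  obtain ⟨enc, henc⟩ := exists_injective_nat S
  have hfin' (β : S) : {j | IsComparable (θ (deg β)) (w β) (lam j)}.Finite :=
    (hfin _ (mul_pos (hθ (deg β)) (hw β))).subset fun j hj => hj.1
  choose t ht using fun β => exists_finset_sum_inner_sq_le e (u β)
    (c := ((1 / 2) ^ (2 * enc β + 1 + 2)) ^ 2) (by positivity)
  obtain ⟨f, hf, hft⟩ := exists_injective_mem_of_almost_spanned e hu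
    (fun β => if good (deg β) then 2 * deg β else 2 * enc β + 1)
    (fun g => by positivity) sum_half_pow_add_two_lt_one
    (fun β => if good (deg β) then (hfin' β).toFinset else t β) fun g B hB a x hx => by
      rcases B.eq_empty_or_nonempty with rfl | ⟨β₀, hβ₀⟩
      · simp
      by_cases hgood : good (deg β₀)
      · obtain rfl : 2 * deg β₀ = g := by simpa [hgood] using hB β₀ hβ₀
        have hBdeg : ∀ β ∈ B, deg β = deg β₀ := fun β hβ => by grind
        refine (hform _ hgood).inner_le hlam h0 hw hu (hθ _) (by positivity) (hθKL _) hBdeg a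
          (t := B.biUnion fun β => (hfin' β).toFinset) (fun j β hβ hj => ?_) fun j hj => ?_
        · simpa only [mem_biUnion, Set.Finite.mem_toFinset] using ⟨β, hβ, hBdeg β hβ ▸ hj⟩
        · obtain ⟨β, hβ, hj⟩ := mem_biUnion.1 hj
          exact hx β hβ j (by simpa only [hBdeg β hβ, if_pos hgood] using hj)
      · obtain rfl : 2 * enc β₀ + 1 = g := by simpa [hgood] using hB β₀ hβ₀
        have hBβ₀ : B = {β₀} := eq_singleton_iff_unique_mem.2 ⟨hβ₀, fun β hβ => henc (by grind)⟩
        subst hBβ₀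
        refine (inner_le_of_sum_inner_sq_le e (A := t β₀) (by positivity) (fun j hj => ?_)
          fun F hF => ?_).trans_eq (mul_left_comm _ _ _)
        · exact hx β₀ hβ₀ j (by rwa [if_neg hgood])
        · rw [mul_pow, norm_sq_sum_smul_of_orthonormal hu]
          simp only [sum_singleton, inner_smul_right, mul_pow, ← mul_sum]
          rw [mul_comm]
          gcongr
          exact ht β₀ F hF
  refine ⟨f, hf, fun β hβ => ?_⟩
  simpa [hβ] using hft β

theorem exists_reindex_hilbertBasis [CompleteSpace H] (e : HilbertBasis J ℝ H) {φ : S → J}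
    (hφ : Function.Bijective φ) : ∃ e' : HilbertBasis S ℝ H, ∀ β, e' β = e (φ β) := by
  have hspan : ⊤ ≤ (Submodule.span ℝ (Set.range (e ∘ φ))).topologicalClosure := by
    rw [Set.range_comp, hφ.surjective.range_eq, Set.image_univ, e.dense_span]
  exact ⟨.mk (e.orthonormal.comp φ hφ.injective) hspan, congrFun (HilbertBasis.coe_mk _ _)⟩

end Matching

section HilbertSchmidt

variable {X : Type*} [MeasurableSpace X] {μ : Measure X} {k k' : X → X → ℝ} {f g : X → ℝ}

theorem eLpNorm_two_sq_eq_lintegral (μ : Measure X) (f : X → ℝ) :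
    eLpNorm f 2 μ ^ 2 = ∫⁻ x, ‖f x‖ₑ ^ 2 ∂μ := by
  simpa using eLpNorm_nnreal_pow_eq_lintegral (μ := μ) (f := f) (p := 2) two_ne_zero

theorem lintegral_enorm_mul_sq_le (hf : AEStronglyMeasurable f μ) (hg : AEStronglyMeasurable g μ) :
    (∫⁻ x, ‖f x‖ₑ * ‖g x‖ₑ ∂μ) ^ 2 ≤ eLpNorm f 2 μ ^ 2 * eLpNorm g 2 μ ^ 2 := by
  have hholder := eLpNorm_smul_le_mul_eLpNorm (p := 2) (q := 2) (r := 1) hg hf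
  rw [eLpNorm_one_eq_lintegral_enorm] at hholder
  rw [← mul_pow]
  gcongr
  simpa only [Pi.smul_apply', smul_eq_mul, enorm_mul] using hholder

theorem IsHilbertSchmidtKernel.sub (hk : IsHilbertSchmidtKernel k μ)
    (hk' : IsHilbertSchmidtKernel k' μ) :
    IsHilbertSchmidtKernel (fun x y => k x y - k' x y) μ :=
  MemLp.sub hk hk'

theorem integralOperator_congr_ae (h : f =ᵐ[μ] g) :
    integralOperator k μ f = integralOperator k μ g :=
  funext fun x => integral_congr_ae (h.mono fun y hy => by simp only [hy])

theorem integralOperator_smul (c : ℝ) :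
    integralOperator k μ (c • f) = c • integralOperator k μ f :=
  funext fun x => by
    simp only [integralOperator, Pi.smul_apply, smul_eq_mul, mul_left_comm _ c, integral_const_mul]

theorem inner_toLp_eq_integral (hf : MemLp f 2 μ) (g : Lp ℝ 2 μ) :
    ⟪hf.toLp f, g⟫_ℝ = ∫ x, f x * g x ∂μ := by
  rw [L2.inner_def]
  refine integral_congr_ae (hf.coeFn_toLp.mono fun x hx => ?_)
  simp only [hx, RCLike.inner_apply, conj_trivial, mul_comm]

theorem integralOperator_sum_mul {ι : Type*} {φ : ι → X → ℝ} (hφ : ∀ i, MemLp (φ i) 2 μ)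
    (c : ι → ℝ) (I : Finset ι) (f : Lp ℝ 2 μ) :
    integralOperator (fun x y => ∑ i ∈ I, c i * (φ i x * φ i y)) μ f
      = fun x => ∑ i ∈ I, c i * ⟪(hφ i).toLp (φ i), f⟫_ℝ * φ i x := by
  ext x
  simp only [integralOperator, sum_mul]
  have hint (i : ι) : Integrable (fun y => c i * (φ i x * φ i y) * f y) μ :=
    (((hφ i).integrable_mul (Lp.memLp f)).const_mul (c i * φ i x)).congr
      (.of_forall fun y => by simp only [Pi.mul_apply]; ring)
  rw [integral_finsetSum _ fun i _ => hint i]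
  refine sum_congr rfl fun i _ => ?_
  rw [inner_toLp_eq_integral, ← integral_const_mul, ← integral_mul_const]
  exact integral_congr_ae (.of_forall fun y => by ring)

variable [SFinite μ]

theorem isHilbertSchmidtKernel_mul (hf : MemLp f 2 μ) (hg : MemLp g 2 μ) :
    IsHilbertSchmidtKernel (fun x y => f x * g y) μ := by
  have hmeas : AEStronglyMeasurable (fun p : X × X => f p.1 * g p.2) (μ.prod μ) :=
    hf.1.comp_fst.mul hg.1.comp_snd
  refine ⟨hmeas, (ENNReal.pow_lt_top_iff (n := 2)).1 ?_ |>.resolve_right two_ne_zero⟩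
  rw [eLpNorm_two_sq_eq_lintegral, lintegral_prod _ (hmeas.enorm.pow_const 2)]
  simp only [enorm_mul, mul_pow, lintegral_const_mul'' _ (hg.1.enorm.pow_const 2)]
  rw [lintegral_mul_const'' _ (hf.1.enorm.pow_const 2), ← eLpNorm_two_sq_eq_lintegral,
    ← eLpNorm_two_sq_eq_lintegral]
  exact ENNReal.mul_lt_top (ENNReal.pow_lt_top hf.2) (ENNReal.pow_lt_top hg.2)

namespace IsHilbertSchmidtKernel

theorem ae_memLp (hk : IsHilbertSchmidtKernel k μ) : ∀ᵐ x ∂μ, MemLp (k x) 2 μ := by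
  filter_upwards [hk.1.prodMk_left, (MemLp.integrable_sq hk).prod_right_ae] with x hmeas hint
  exact (memLp_two_iff_integrable_sq hmeas).2 hint

theorem eLpNorm_integralOperator_le (hk : IsHilbertSchmidtKernel k μ) (hf : MemLp f 2 μ) :
    eLpNorm (integralOperator k μ f) 2 μ
      ≤ eLpNorm (fun p : X × X => k p.1 p.2) 2 (μ.prod μ) * eLpNorm f 2 μ := by
  have hmeas := hk.1.enorm.pow_const 2
  rw [← ENNReal.pow_le_pow_left_iff two_ne_zero, mul_pow, eLpNorm_two_sq_eq_lintegral μ,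
    eLpNorm_two_sq_eq_lintegral (μ.prod μ), lintegral_prod _ hmeas,
    ← lintegral_mul_const'' _ hmeas.lintegral_prod_right']
  refine lintegral_mono_ae (hk.ae_memLp.mono fun x hx => ?_)
  rw [← eLpNorm_two_sq_eq_lintegral]
  refine (pow_le_pow_left₀ zero_le ?_ 2).trans (lintegral_enorm_mul_sq_le hx.1 hf.1)
  exact (enorm_integral_le_lintegral_enorm _).trans_eq (by simp only [enorm_mul])

theorem memLp_integralOperator (hk : IsHilbertSchmidtKernel k μ) (hf : MemLp f 2 μ) :
    MemLp (integralOperator k μ f) 2 μ :=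
  ⟨(hk.1.mul hf.1.comp_snd).integral_prod_right',
    (hk.eLpNorm_integralOperator_le hf).trans_lt (ENNReal.mul_lt_top hk.2 hf.2)⟩

theorem integralOperator_add_ae (hk : IsHilbertSchmidtKernel k μ) (hf : MemLp f 2 μ)
    (hg : MemLp g 2 μ) :
    integralOperator k μ (f + g) =ᵐ[μ] integralOperator k μ f + integralOperator k μ g := by
  filter_upwards [hk.ae_memLp] with x hx
  simp only [integralOperator, Pi.add_apply, mul_add]
  exact integral_add (hx.integrable_mul hf) (hx.integrable_mul hg)

theorem integralOperator_sub_kernel_ae (hk : IsHilbertSchmidtKernel k μ)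
    (hk' : IsHilbertSchmidtKernel k' μ) (hf : MemLp f 2 μ) :
    integralOperator (fun x y => k x y - k' x y) μ f
      =ᵐ[μ] integralOperator k μ f - integralOperator k' μ f := by
  filter_upwards [hk.ae_memLp, hk'.ae_memLp] with x hx hx'
  simp only [integralOperator, Pi.sub_apply, sub_mul]
  exact integral_sub (hx.integrable_mul hf) (hx'.integrable_mul hf)

/-- The integral operator of a Hilbert-Schmidt kernel, as a bounded operator on `L²(μ)`. -/
noncomputable def toCLM (hk : IsHilbertSchmidtKernel k μ) : Lp ℝ 2 μ →L[ℝ] Lp ℝ 2 μ :=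
  LinearMap.mkContinuous
    { toFun := fun f => (hk.memLp_integralOperator (Lp.memLp f)).toLp _
      map_add' := fun f g => by
        rw [← MemLp.toLp_add]
        refine MemLp.toLp_congr _ _ ?_
        rw [integralOperator_congr_ae (Lp.coeFn_add f g)]
        exact hk.integralOperator_add_ae (Lp.memLp f) (Lp.memLp g)
      map_smul' := fun c f => by
        rw [RingHom.id_apply, ← MemLp.toLp_const_smul]
        refine MemLp.toLp_congr _ _ (.of_eq ?_)
        rw [integralOperator_congr_ae (Lp.coeFn_smul c f), integralOperator_smul] }
    (eLpNorm (fun p : X × X => k p.1 p.2) 2 (μ.prod μ)).toReal fun f => by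
      rw [LinearMap.coe_mk, AddHom.coe_mk, Lp.norm_toLp, Lp.norm_def, ← ENNReal.toReal_mul]
      exact ENNReal.toReal_mono (ENNReal.mul_ne_top hk.2.ne (Lp.memLp f).2.ne)
        (hk.eLpNorm_integralOperator_le (Lp.memLp f))

theorem coeFn_toCLM (hk : IsHilbertSchmidtKernel k μ) (f : Lp ℝ 2 μ) :
    hk.toCLM f =ᵐ[μ] integralOperator k μ f :=
  MemLp.coeFn_toLp (hk.memLp_integralOperator (Lp.memLp f))

theorem norm_toCLM_le (hk : IsHilbertSchmidtKernel k μ) :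
    ‖hk.toCLM‖ ≤ (eLpNorm (fun p : X × X => k p.1 p.2) 2 (μ.prod μ)).toReal :=
  LinearMap.mkContinuous_norm_le _ ENNReal.toReal_nonneg _

theorem toCLM_sub (hk : IsHilbertSchmidtKernel k μ) (hk' : IsHilbertSchmidtKernel k' μ) :
    (hk.sub hk').toCLM = hk.toCLM - hk'.toCLM := by
  ext1 f
  ext1
  refine ((hk.sub hk').coeFn_toCLM f).trans ?_
  filter_upwards [hk.integralOperator_sub_kernel_ae hk' (Lp.memLp f), hk.coeFn_toCLM f,
    hk'.coeFn_toCLM f, Lp.coeFn_sub (hk.toCLM f) (hk'.toCLM f)] with x hx hf hf' hsub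
  rw [hx, sub_apply, hsub, Pi.sub_apply, Pi.sub_apply, hf, hf']

theorem toCLM_sum_mul {ι : Type*} {φ : ι → X → ℝ} (hφ : ∀ i, MemLp (φ i) 2 μ) (c : ι → ℝ)
    (I : Finset ι) (hk : IsHilbertSchmidtKernel (fun x y => ∑ i ∈ I, c i * (φ i x * φ i y)) μ) :
    hk.toCLM = ∑ i ∈ I, c i • InnerProductSpace.rankOne ℝ ((hφ i).toLp (φ i))
      ((hφ i).toLp (φ i)) := by
  ext1 f
  ext1
  refine (hk.coeFn_toCLM f).trans ?_
  rw [integralOperator_sum_mul hφ]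
  simp only [_root_.sum_apply, smul_apply, InnerProductSpace.rankOne_apply, smul_smul]
  filter_upwards [Lp.coeFn_finsetSum I fun i => (c i * ⟪(hφ i).toLp (φ i), f⟫_ℝ) •
      (hφ i).toLp (φ i), (ae_ball_iff I.countable_toSet).2 fun i _ =>
      (Lp.coeFn_smul (c i * ⟪(hφ i).toLp (φ i), f⟫_ℝ) ((hφ i).toLp (φ i))).trans
        ((hφ i).coeFn_toLp.const_smul _)] with x hsum hterm
  rw [hsum, Finset.sum_apply]
  exact sum_congr rfl fun i hi => (hterm i hi).symm

theorem tendsto_toCLM {ι : Type*} {l : Filter ι} {kN : ι → X → X → ℝ}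
    (hk : IsHilbertSchmidtKernel k μ) (hkN : ∀ N, IsHilbertSchmidtKernel (kN N) μ)
    (hlim : Tendsto (fun N => eLpNorm (fun p : X × X => k p.1 p.2 - kN N p.1 p.2) 2 (μ.prod μ)) l
      (𝓝 0)) : Tendsto (fun N => (hkN N).toCLM) l (𝓝 hk.toCLM) := by
  rw [tendsto_iff_norm_sub_tendsto_zero]
  refine squeeze_zero (fun _ => norm_nonneg _) (fun N => ?_)
    ((ENNReal.tendsto_toReal ENNReal.zero_ne_top).comp hlim)
  rw [norm_sub_rev, ← hk.toCLM_sub (hkN N)]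
  exact (hk.sub (hkN N)).norm_toCLM_le

end IsHilbertSchmidtKernel

end HilbertSchmidt

section RankOneSeries

variable {H ι κ : Type*} [NormedAddCommGroup H] [InnerProductSpace ℝ H] {ψ : ι → H} {c : ι → ℝ}
  {I : κ → Finset ι} {l : Filter κ} {T : H →L[ℝ] H}

theorem isCompactOperator_sum_rankOne (ψ : ι → H) (c : ι → ℝ) (I : Finset ι) :
    IsCompactOperator (∑ i ∈ I, c i • InnerProductSpace.rankOne ℝ (ψ i) (ψ i) : H →L[ℝ] H) := by
  have hmem : ∑ i ∈ I, c i • InnerProductSpace.rankOne ℝ (ψ i) (ψ i) ∈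
      compactOperator (RingHom.id ℝ) H H := by
    refine Submodule.sum_mem _ fun i _ => Submodule.smul_mem _ _ ?_
    exact (isCompactOperator_of_locallyCompactSpace_dom (innerSL ℝ (ψ i))).clm_comp
      (ContinuousLinearMap.toSpanSingleton ℝ (ψ i))
  exact hmem

theorem inner_sum_rankOne_apply (ψ : ι → H) (c : ι → ℝ) (I : Finset ι) (f g : H) :
    ⟪(∑ i ∈ I, c i • InnerProductSpace.rankOne ℝ (ψ i) (ψ i)) f, g⟫_ℝ
      = ∑ i ∈ I, c i * (⟪ψ i, f⟫_ℝ * ⟪ψ i, g⟫_ℝ) := by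
  simp [sum_inner, inner_smul_left]

theorem tendsto_sum_mul_inner_of_tendsto_sum_rankOne
    (hT : Tendsto (fun N => ∑ i ∈ I N, c i • InnerProductSpace.rankOne ℝ (ψ i) (ψ i)) l (𝓝 T))
    (f g : H) :
    Tendsto (fun N => ∑ i ∈ I N, c i * (⟪ψ i, f⟫_ℝ * ⟪ψ i, g⟫_ℝ)) l (𝓝 ⟪T f, g⟫_ℝ) := by
  simp_rw [← inner_sum_rankOne_apply]
  exact (((ContinuousLinearMap.apply ℝ H f).continuous.tendsto T).comp hT).inner tendsto_const_nhds

theorem isSymmetric_of_tendsto_sum_rankOne [NeBot l]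
    (hT : Tendsto (fun N => ∑ i ∈ I N, c i • InnerProductSpace.rankOne ℝ (ψ i) (ψ i)) l (𝓝 T)) :
    (T : H →ₗ[ℝ] H).IsSymmetric := by
  intro f g
  have hswap := tendsto_sum_mul_inner_of_tendsto_sum_rankOne hT g f
  simp only [mul_comm ⟪ψ _, g⟫_ℝ] at hswap
  exact (tendsto_nhds_unique (tendsto_sum_mul_inner_of_tendsto_sum_rankOne hT f g) hswap).trans
    (real_inner_comm _ _)

theorem hasSum_of_tendsto_sum_rankOne [SemilatticeSup κ] [Nonempty κ] (hc : ∀ i, 0 ≤ c i)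
    (hI : Tendsto I atTop atTop)
    (hT : Tendsto (fun N => ∑ i ∈ I N, c i • InnerProductSpace.rankOne ℝ (ψ i) (ψ i)) atTop (𝓝 T))
    (f : H) : HasSum (fun i => c i * ⟪ψ i, f⟫_ℝ ^ 2) ⟪T f, f⟫_ℝ := by
  classical
  have hmono : Monotone fun s : Finset ι => ∑ i ∈ s, c i * ⟪ψ i, f⟫_ℝ ^ 2 := fun s t hst =>
    sum_le_sum_of_subset_of_nonneg hst fun i _ _ => mul_nonneg (hc i) (sq_nonneg _)
  have hlim := tendsto_sum_mul_inner_of_tendsto_sum_rankOne hT f f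
  simp only [← sq] at hlim
  exact (tendsto_iff_tendsto_subseq_of_monotone hmono hI).2 hlim

end RankOneSeries

section Hermite

open Polynomial

variable {v : ℝ≥0}

theorem integrable_eval_gaussianReal (v : ℝ≥0) (p : ℝ[X]) :
    Integrable (fun x => p.eval x) (gaussianReal 0 v) := by
  simp only [eval_eq_sum_range]
  exact integrable_finsetSum _ fun i _ =>
    (integrable_pow_of_mem_interior_integrableExpSet (X := id) (by simp) i).const_mul _

theorem integrable_eval_mul_gaussianPDFReal (hv : v ≠ 0) (p : ℝ[X]) :
    Integrable fun x => p.eval x * gaussianPDFReal 0 v x := by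
  have h := integrable_eval_gaussianReal v p
  rw [gaussianReal_of_var_ne_zero 0 hv, gaussianPDF_def,
    integrable_withDensity_iff (by fun_prop) (by simp)] at h
  simpa only [ENNReal.toReal_ofReal (gaussianPDFReal_nonneg 0 v _)] using h

theorem hasDerivAt_gaussianPDFReal (v : ℝ≥0) (x : ℝ) :
    HasDerivAt (gaussianPDFReal 0 v) (-(x / v) * gaussianPDFReal 0 v x) x := by
  have hexponent : HasDerivAt (fun x : ℝ => -(x - 0) ^ 2 / (2 * (v : ℝ))) (-(x / v)) x := by
    refine (((hasDerivAt_id x).sub_const 0).pow 2).neg.div_const (2 * (v : ℝ)) |>.congr_deriv ?_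
    simp [mul_div_mul_left, neg_div]
  refine (hexponent.exp.const_mul (√(2 * Real.pi * v))⁻¹).congr_deriv ?_
  rw [gaussianPDFReal]
  ring

theorem integral_X_mul_gaussianReal (v : ℝ≥0) (p : ℝ[X]) :
    ∫ x, (X * p).eval x ∂gaussianReal 0 v = v * ∫ x, (derivative p).eval x ∂gaussianReal 0 v := by
  rcases eq_or_ne v 0 with rfl | hv
  · simp
  have hv' : (v : ℝ) ≠ 0 := by simpa using hv
  have hparts := integral_mul_deriv_eq_deriv_mul_of_integrable
    (fun x _ => p.hasDerivAt x) (fun x _ => hasDerivAt_gaussianPDFReal v x) ?_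
    (integrable_eval_mul_gaussianPDFReal hv (derivative p))
    (integrable_eval_mul_gaussianPDFReal hv p)
  · simp only [integral_gaussianReal_eq_integral_smul hv, smul_eq_mul]
    simp only [mul_comm (gaussianPDFReal 0 v _)]
    rw [← neg_eq_iff_eq_neg.2 hparts, ← integral_neg, ← integral_const_mul]
    refine integral_congr_ae (.of_forall fun x => ?_)
    simp only [eval_mul, eval_X]
    field_simp
  · refine ((integrable_eval_mul_gaussianPDFReal hv (X * p)).const_mul (-(v : ℝ)⁻¹)).congr
      (.of_forall fun x => ?_)
    simp only [Pi.mul_apply, eval_mul, eval_X]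
    field_simp

theorem integral_pow_add_two_gaussianReal (v : ℝ≥0) (n : ℕ) :
    ∫ x, x ^ (n + 2) ∂gaussianReal 0 v = v * (n + 1) * ∫ x, x ^ n ∂gaussianReal 0 v := by
  have hstein := integral_X_mul_gaussianReal v (X ^ (n + 1))
  simp only [← pow_succ', derivative_X_pow_succ, eval_mul, eval_pow, eval_X, eval_C,
    integral_const_mul] at hstein
  exact hstein.trans (mul_assoc _ _ _).symm

theorem integral_pow_gaussianReal_of_odd (v : ℝ≥0) {n : ℕ} (hn : Odd n) :
    ∫ x, x ^ n ∂gaussianReal 0 v = 0 := by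
  induction n using Nat.twoStepInduction with
  | zero => simp at hn
  | one => simp [integral_id_gaussianReal]
  | more n ih _ =>
    rw [integral_pow_add_two_gaussianReal, ih (by simpa [parity_simps] using hn), mul_zero]

theorem sq_integral_pow_gaussianReal_le (v : ℝ≥0) (n : ℕ) :
    (∫ x, x ^ n ∂gaussianReal 0 v) ^ 2 ≤ v ^ n * n.factorial := by
  induction n using Nat.twoStepInduction with
  | zero => simp
  | one => simp [integral_id_gaussianReal]
  | more n ih _ =>
    rw [integral_pow_add_two_gaussianReal, mul_pow]
    calc ((v : ℝ) * (n + 1)) ^ 2 * (∫ x, x ^ n ∂gaussianReal 0 v) ^ 2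
        ≤ ((v : ℝ) * (n + 1)) ^ 2 * (v ^ n * n.factorial) := by gcongr
      _ = (v : ℝ) ^ (n + 2) * ((n + 1) * ((n + 1) * n.factorial)) := by ring
      _ ≤ (v : ℝ) ^ (n + 2) * ((n + 2) * ((n + 1) * n.factorial)) := by gcongr; norm_num
      _ = (v : ℝ) ^ (n + 2) * (n + 2).factorial := by
        rw [Nat.factorial_succ (n + 1), Nat.factorial_succ n]
        push_cast
        ring

/-- The weight `κ ^ k` if `a = b + 2 * k`, and `0` if `a` is not of this form. It dominates both the
coefficient of `x ^ b` in the Hermite polynomial of degree `a` and the inner product of `x ^ a` with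
the Hermite polynomial of degree `b`. -/
noncomputable def parityWeight (κ : ℝ) (a b : ℕ) : ℝ :=
  if b ≤ a ∧ Even (a - b) then κ ^ ((a - b) / 2) else 0

theorem parityWeight_nonneg {κ : ℝ} (hκ : 0 ≤ κ) (a b : ℕ) : 0 ≤ parityWeight κ a b := by
  unfold parityWeight
  split_ifs <;> positivity

theorem parityWeight_add_two_mul (κ : ℝ) (b k : ℕ) : parityWeight κ (b + 2 * k) b = κ ^ k := by
  simp [parityWeight]

theorem eq_add_two_mul_or_parityWeight_eq_zero (κ : ℝ) (a b : ℕ) :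
    (∃ k, a = b + 2 * k) ∨ parityWeight κ a b = 0 := by
  by_cases h : b ≤ a ∧ Even (a - b)
  · obtain ⟨k, hk⟩ := h.2
    exact .inl ⟨k, by lia⟩
  · exact .inr (if_neg h)

theorem parityWeight_succ_succ (κ : ℝ) (a b : ℕ) :
    parityWeight κ (a + 1) (b + 1) = parityWeight κ a b := by
  simp [parityWeight]

theorem parityWeight_eq_mul_of_add_two_le (κ : ℝ) {a b : ℕ} (h : b + 2 ≤ a) :
    parityWeight κ a b = κ * parityWeight κ a (b + 2) := by
  obtain ⟨c, rfl⟩ := Nat.exists_eq_add_of_le' h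
  simp only [parityWeight, ← pow_succ', mul_ite, mul_zero]
  have : c + (b + 2) - b = c + 2 := by lia
  have hle : b ≤ c + (b + 2) := by lia
  simp [this, hle, parity_simps]

/-- The monic Hermite polynomials that are orthogonal for the centred Gaussian measure of variance
`v`; those of variance `1` are the `Polynomial.hermite`. -/
noncomputable def gaussHermite (v : ℝ) : ℕ → ℝ[X]
  | 0 => 1
  | n + 1 => X * gaussHermite v n - C v * derivative (gaussHermite v n)

theorem coeff_gaussHermite (v : ℝ) (n j : ℕ) :
    (gaussHermite v n).coeff j = (hermite n).coeff j * parityWeight v n j := by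
  induction n generalizing j with
  | zero =>
    rcases j with _ | j
    · simp [gaussHermite, parityWeight]
    · simp [gaussHermite, coeff_one]
  | succ n ih =>
    rw [gaussHermite, coeff_sub, coeff_C_mul, coeff_derivative, ih]
    rcases j with _ | j
    · rw [coeff_X_mul_zero, coeff_hermite_succ_zero]
      rcases n with _ | n
      · simp [coeff_one]
      · rw [parityWeight_eq_mul_of_add_two_le v (a := n + 1 + 1) (b := 0) (by lia),
          parityWeight_succ_succ v (n + 1) 1]
        push_cast
        ring
    · rw [coeff_X_mul, ih, coeff_hermite_succ_succ, parityWeight_succ_succ]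
      rcases lt_or_ge n (j + 2) with h | h
      · simp [coeff_hermite_of_lt h]
      · rw [parityWeight_eq_mul_of_add_two_le v h]
        push_cast
        ring

theorem doubleFactorial_le_doubleFactorial_succ (n : ℕ) :
    n.doubleFactorial ≤ (n + 1).doubleFactorial := by
  induction n using Nat.twoStepInduction with
  | zero => rfl
  | one => simp [Nat.doubleFactorial]
  | more n ih _ =>
    rw [Nat.doubleFactorial_add_two, Nat.doubleFactorial_add_two]
    gcongr
    exact n.le_succ

theorem sq_doubleFactorial_sub_one_le_factorial (m : ℕ) :
    (Nat.doubleFactorial (m - 1)) ^ 2 ≤ m.factorial := by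
  rcases m with _ | m
  · simp
  · rw [Nat.factorial_eq_mul_doubleFactorial, sq, Nat.add_sub_cancel]
    gcongr
    exact doubleFactorial_le_doubleFactorial_succ m

theorem sq_coeff_hermite_le (n j : ℕ) : (hermite n).coeff j ^ 2 ≤ 2 ^ n * (n.factorial : ℤ) := by
  rw [coeff_hermite]
  split_ifs with h
  · rcases lt_or_ge n j with hj | hj
    · simp [Nat.choose_eq_zero_of_lt hj]
    rw [mul_pow, mul_pow, ← pow_mul, mul_comm _ 2, pow_mul, neg_one_sq, one_pow, one_mul]
    norm_cast
    calc (n - j - 1).doubleFactorial ^ 2 * n.choose j ^ 2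
        ≤ (n - j).factorial * (j.factorial * n.choose j * n.choose j) := by
          gcongr ?_ * ?_
          · exact sq_doubleFactorial_sub_one_le_factorial _
          · rw [sq]
            gcongr
            exact Nat.le_mul_of_pos_left _ (Nat.factorial_pos j)
      _ = n.choose j * n.factorial := by rw [← Nat.choose_mul_factorial_mul_factorial hj]; ring
      _ ≤ _ := by gcongr; exact Nat.choose_le_two_pow n j
  · positivity

theorem sq_coeff_gaussHermite_le {v : ℝ} (n j : ℕ) :
    (gaussHermite v n).coeff j ^ 2 ≤ 2 ^ n * n.factorial * parityWeight v n j ^ 2 := by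
  rw [coeff_gaussHermite, mul_pow]
  gcongr
  exact_mod_cast sq_coeff_hermite_le n j

theorem integral_mul_gaussHermite (v : ℝ≥0) (p : ℝ[X]) (n : ℕ) :
    ∫ x, (p * gaussHermite v n).eval x ∂gaussianReal 0 v
      = v ^ n * ∫ x, (derivative^[n] p).eval x ∂gaussianReal 0 v := by
  induction n generalizing p with
  | zero => simp [gaussHermite]
  | succ n ih =>
    have hstein := integral_X_mul_gaussianReal v (p * gaussHermite v n)
    rw [Function.iterate_succ_apply, pow_succ', mul_assoc, ← ih]
    calc ∫ x, (p * gaussHermite v (n + 1)).eval x ∂gaussianReal 0 v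
        = ∫ x, (X * (p * gaussHermite v n)).eval x
            - v * (p * derivative (gaussHermite v n)).eval x ∂gaussianReal 0 v := by
          refine integral_congr_ae (.of_forall fun x => ?_)
          simp only [gaussHermite, eval_mul, eval_sub, eval_X, eval_C]
          ring
      _ = v * ∫ x, (derivative p * gaussHermite v n).eval x ∂gaussianReal 0 v := by
          rw [integral_sub (integrable_eval_gaussianReal v _)
            ((integrable_eval_gaussianReal v _).const_mul _), hstein, integral_const_mul,
            ← mul_sub, ← integral_sub (integrable_eval_gaussianReal v _)
            (integrable_eval_gaussianReal v _)]
          simp only [derivative_mul, eval_add, add_sub_cancel_right]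

theorem integral_pow_mul_gaussHermite (v : ℝ≥0) (a b : ℕ) :
    ∫ x, x ^ a * (gaussHermite v b).eval x ∂gaussianReal 0 v
      = v ^ b * (a.descFactorial b * ∫ x, x ^ (a - b) ∂gaussianReal 0 v) := by
  have h := integral_mul_gaussHermite v (X ^ a) b
  simpa only [iterate_derivative_X_pow_eq_natCast_mul, eval_mul, eval_pow, eval_X, eval_natCast,
    integral_const_mul] using h

theorem natDegree_gaussHermite_le (v : ℝ) (n : ℕ) : (gaussHermite v n).natDegree ≤ n :=
  natDegree_le_iff_coeff_eq_zero.2 fun j hj => by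
    rw [coeff_gaussHermite, coeff_hermite_of_lt hj, Int.cast_zero, zero_mul]

theorem integral_gaussHermite_mul (v : ℝ≥0) (a b : ℕ) :
    ∫ x, (gaussHermite v a).eval x * (gaussHermite v b).eval x ∂gaussianReal 0 v
      = if a = b then (v : ℝ) ^ b * b.factorial else 0 := by
  wlog hab : a ≤ b generalizing a b
  · simp only [mul_comm ((gaussHermite v a).eval _), eq_comm (a := a), this b a (by lia)]
    split_ifs with h
    · rw [h]
    · rfl
  simp only [← eval_mul, integral_mul_gaussHermite]
  rcases hab.eq_or_lt with rfl | hlt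
  · have hconst : derivative^[a] (gaussHermite v a) = C (a.factorial : ℝ) := by
      rw [eq_C_of_natDegree_le_zero ((natDegree_iterate_derivative _ a).trans
        (tsub_eq_zero_of_le (natDegree_gaussHermite_le v a)).le), coeff_iterate_derivative,
        zero_add, coeff_gaussHermite, coeff_hermite_self, Nat.descFactorial_self]
      simp [parityWeight]
    simp [hconst]
  · rw [iterate_derivative_eq_zero ((natDegree_gaussHermite_le v a).trans_lt hlt), if_neg hlt.ne]
    simp

end Hermite

section WeightedSums

theorem sum_mul_sq_sum_mul_le {ι κ : Type*} {I : Finset ι} {J : Finset κ} {A p q : ι → κ → ℝ}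
    {c : ι → ℝ} {w : κ → ℝ} {P Q : ℝ} (hc : ∀ i, 0 ≤ c i) (hw : ∀ j, 0 ≤ w j)
    (hp : ∀ i j, 0 ≤ p i j) (hq : ∀ i j, 0 ≤ q i j)
    (hA : ∀ i ∈ I, ∀ j ∈ J, c i * A i j ^ 2 ≤ p i j * (q i j * w j)) (hP₀ : 0 ≤ P)
    (hP : ∀ i ∈ I, ∑ j ∈ J, p i j ≤ P) (hQ : ∀ j ∈ J, ∑ i ∈ I, q i j ≤ Q) (x : κ → ℝ) :
    ∑ i ∈ I, c i * (∑ j ∈ J, A i j * x j) ^ 2 ≤ P * Q * ∑ j ∈ J, w j * x j ^ 2 := by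
  have hrow (i : ι) (hi : i ∈ I) :
      c i * (∑ j ∈ J, A i j * x j) ^ 2 ≤ P * ∑ j ∈ J, q i j * (w j * x j ^ 2) := by
    have hx (j : κ) : 0 ≤ q i j * (w j * x j ^ 2) :=
      mul_nonneg (hq i j) (mul_nonneg (hw j) (sq_nonneg _))
    calc c i * (∑ j ∈ J, A i j * x j) ^ 2 = (∑ j ∈ J, √(c i) * (A i j * x j)) ^ 2 := by
          rw [← mul_sum, mul_pow, Real.sq_sqrt (hc i)]
      _ ≤ (∑ j ∈ J, p i j) * ∑ j ∈ J, q i j * (w j * x j ^ 2) := by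
          refine sum_sq_le_sum_mul_sum_of_sq_le_mul J (fun j _ => hp i j) (fun j _ => hx j)
            fun j hj => ?_
          rw [mul_pow, mul_pow, Real.sq_sqrt (hc i), ← mul_assoc, ← mul_assoc (q i j), ← mul_assoc]
          exact mul_le_mul_of_nonneg_right (hA i hi j hj) (sq_nonneg _)
      _ ≤ _ := mul_le_mul_of_nonneg_right (hP i hi) (sum_nonneg fun j _ => hx j)
  calc _ ≤ ∑ i ∈ I, P * ∑ j ∈ J, q i j * (w j * x j ^ 2) := sum_le_sum hrow
    _ = P * ∑ j ∈ J, (∑ i ∈ I, q i j) * (w j * x j ^ 2) := by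
        rw [← mul_sum, sum_comm]
        simp only [sum_mul]
    _ ≤ P * ∑ j ∈ J, Q * (w j * x j ^ 2) := by
        gcongr with j hj
        · exact mul_nonneg (hw j) (sq_nonneg _)
        · exact hQ j hj
    _ = _ := by rw [← mul_sum, mul_assoc]

theorem sum_prod_le_prod_of_sum_le {ι : Type*} [Fintype ι] {f : ι → ℕ → ℝ}
    {C : ι → ℝ} (B : Finset (ι → ℕ)) (hf : ∀ i j, 0 ≤ f i j)
    (hC : ∀ i, ∑ j ∈ B.image (· i), f i j ≤ C i) :
    ∑ β ∈ B, ∏ i, f i (β i) ≤ ∏ i, C i := by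
  classical
  calc ∑ β ∈ B, ∏ i, f i (β i)
      ≤ ∑ β ∈ Fintype.piFinset fun i => B.image (· i), ∏ i, f i (β i) :=
        sum_le_sum_of_subset_of_nonneg
          (fun β hβ => Fintype.mem_piFinset.2 fun i => mem_image_of_mem (· i) hβ)
          fun β _ _ => prod_nonneg fun i _ => hf i (β i)
    _ = ∏ i, ∑ j ∈ B.image (· i), f i j := (prod_univ_sum _ _).symm
    _ ≤ ∏ i, C i := prod_le_prod (fun i _ => sum_nonneg fun j _ => hf i j) fun i _ => hC i

theorem exists_sum_parityWeight_mul_left_eq (κ : ℝ) (b : ℕ) (A : Finset ℕ) (c : ℕ → ℝ) :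
    ∃ K : Finset ℕ, (∀ k ∈ K, b + 2 * k ∈ A) ∧
      ∑ a ∈ A, parityWeight κ a b * c a = ∑ k ∈ K, κ ^ k * c (b + 2 * k) := by
  have hinj : Function.Injective fun k => b + 2 * k := fun k l h => by grind
  refine ⟨A.preimage (b + 2 * ·) hinj.injOn, fun k hk => by simpa using hk, ?_⟩
  rw [← sum_preimage _ A hinj.injOn (fun a => parityWeight κ a b * c a) fun a _ ha => ?_]
  · simp only [parityWeight_add_two_mul]
  · rcases eq_add_two_mul_or_parityWeight_eq_zero κ a b with ⟨k, rfl⟩ | h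
    · exact absurd ⟨k, rfl⟩ ha
    · rw [h, zero_mul]

theorem exists_sum_parityWeight_right_eq (κ : ℝ) (a : ℕ) (A : Finset ℕ) :
    ∃ K : Finset ℕ, (∀ k ∈ K, k ≤ a) ∧ ∑ b ∈ A, parityWeight κ a b = ∑ k ∈ K, κ ^ k := by
  refine ⟨{b ∈ A | b ≤ a ∧ Even (a - b)}.image fun b => (a - b) / 2, by grind, ?_⟩
  rw [sum_image, sum_filter]
  · rfl
  · intro b hb b' hb' h
    simp only [coe_filter, Set.mem_ofPred_eq] at hb hb'
    grind

theorem sum_pow_le_exp {x c : ℝ} (hx : 0 ≤ x) (hc : 0 < c) (hxc : c⁻¹ ≤ 1 - x) (A : Finset ℕ) :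
    ∑ k ∈ A, x ^ k ≤ Real.exp (c * x) := by
  have hx1 : 0 < 1 - x := (inv_pos.2 hc).trans_le hxc
  calc ∑ k ∈ A, x ^ k ≤ (1 - x)⁻¹ :=
        sum_le_hasSum A (fun k _ => pow_nonneg hx k) (hasSum_geometric_of_lt_one hx (by linarith))
    _ = (1 - x)⁻¹ * x + 1 := by field_simp; ring
    _ ≤ c * x + 1 := by gcongr; exact inv_le_of_inv_le₀ hc hxc
    _ ≤ Real.exp (c * x) := Real.add_one_le_exp _

theorem sum_pow_le_exp_of_subset_range {x t : ℝ} {n : ℕ} {A : Finset ℕ} (hx : 0 ≤ x) (hxt : x ≤ t)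
    (hA : A ⊆ range (n + 1)) : ∑ k ∈ A, x ^ k ≤ Real.exp ((∑ j ∈ range n, t ^ j) * x) :=
  calc ∑ k ∈ A, x ^ k ≤ ∑ k ∈ range (n + 1), x ^ k :=
        sum_le_sum_of_subset_of_nonneg hA fun k _ _ => pow_nonneg hx k
    _ = (∑ j ∈ range n, x ^ j) * x + 1 := by
        rw [sum_range_succ', pow_zero, sum_mul]
        simp only [pow_succ]
    _ ≤ (∑ j ∈ range n, t ^ j) * x + 1 := by gcongr
    _ ≤ _ := Real.add_one_le_exp _

theorem choose_mul_pow_le_one {t : ℝ} (h0 : 0 ≤ t) (h1 : t ≤ 1) (m n : ℕ) :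
    ((m + n).choose m : ℝ) * (t ^ m * (1 - t) ^ n) ≤ 1 :=
  calc ((m + n).choose m : ℝ) * (t ^ m * (1 - t) ^ n)
      = t ^ m * (1 - t) ^ (m + n - m) * ((m + n).choose m) := by
        rw [add_tsub_cancel_left, mul_comm]
    _ ≤ ∑ j ∈ range (m + n + 1), t ^ j * (1 - t) ^ (m + n - j) * ((m + n).choose j) :=
        single_le_sum (f := fun j => t ^ j * (1 - t) ^ (m + n - j) * ((m + n).choose j : ℝ))
          (fun j _ => by have := sub_nonneg.2 h1; positivity) (by simp)
    _ = 1 := by rw [← add_pow, add_sub_cancel, one_pow]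

theorem choose_add_two_mul_le (b k : ℕ) :
    ((b + 2 * k).choose b : ℝ) ≤ 5 ^ b * (25 / 16) ^ k := by
  have h := choose_mul_pow_le_one (t := 1 / 5) (by norm_num) (by norm_num) b (2 * k)
  rw [pow_mul, show ((1 : ℝ) - 1 / 5) ^ 2 = (25 / 16)⁻¹ by norm_num, one_div, inv_pow, inv_pow,
    ← mul_inv, ← div_eq_mul_inv, div_le_one (by positivity)] at h
  exact h

theorem sum_parityWeight_right_le_exp {κ : ℝ} (h0 : 0 ≤ κ) (h1 : κ ≤ 3 / 5) (a : ℕ)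
    (A : Finset ℕ) : ∑ b ∈ A, parityWeight κ a b ≤ Real.exp (25 * κ) := by
  obtain ⟨K, -, hK⟩ := exists_sum_parityWeight_right_eq κ a A
  rw [hK]
  exact sum_pow_le_exp h0 (by norm_num) (by linarith) K

theorem sum_parityWeight_mul_choose_le_exp {κ : ℝ} (h0 : 0 ≤ κ) (h1 : κ ≤ 3 / 5) (b : ℕ)
    (A : Finset ℕ) :
    ∑ a ∈ A, parityWeight κ a b * a.choose b ≤ 5 ^ b * Real.exp (25 * κ) := by
  obtain ⟨K, -, hK⟩ := exists_sum_parityWeight_mul_left_eq κ b A fun a => (a.choose b : ℝ)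
  calc ∑ a ∈ A, parityWeight κ a b * a.choose b
      ≤ ∑ k ∈ K, κ ^ k * (5 ^ b * (25 / 16) ^ k) := by
        rw [hK]
        gcongr with k
        exact choose_add_two_mul_le b k
    _ = 5 ^ b * ∑ k ∈ K, (κ * (25 / 16)) ^ k := by
        rw [mul_sum]
        simp only [mul_pow, mul_left_comm]
    _ ≤ 5 ^ b * Real.exp (16 * (κ * (25 / 16))) := by
        gcongr
        exact sum_pow_le_exp (by positivity) (by norm_num) (by linarith) K
    _ = _ := by congr 2; ring

end WeightedSums

section GaussianL2

open Polynomial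

variable {d : ℕ} {σ : Fin d → ℝ≥0}

instance (σ : Fin d → ℝ≥0) : IsProbabilityMeasure (diagGaussian σ) :=
  inferInstanceAs (IsProbabilityMeasure (Measure.pi _))

/-- The product `x ↦ ∏ i, p i (x i)` of univariate polynomials in separate variables. -/
noncomputable def prodPoly (p : Fin d → ℝ[X]) (x : Fin d → ℝ) : ℝ := ∏ i, (p i).eval (x i)

theorem prodPoly_mul (p q : Fin d → ℝ[X]) (x : Fin d → ℝ) :
    prodPoly p x * prodPoly q x = prodPoly (fun i => p i * q i) x := by
  simp only [prodPoly, eval_mul, prod_mul_distrib]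

theorem prodPoly_eq_sum {p : Fin d → ℝ[X]} {n : ℕ} (hp : ∀ i, (p i).natDegree ≤ n)
    (x : Fin d → ℝ) :
    prodPoly p x = ∑ α ∈ Fintype.piFinset fun _ => range (n + 1),
      (∏ i, (p i).coeff (α i)) * prodPoly (fun i => X ^ α i) x := by
  simp only [prodPoly, eval_eq_sum_range' (Nat.lt_succ_of_le (hp _)), prod_univ_sum,
    ← prod_mul_distrib, eval_pow, eval_X]

theorem memLp_prodPoly (σ : Fin d → ℝ≥0) (p : Fin d → ℝ[X]) :
    MemLp (prodPoly p) 2 (diagGaussian σ) := by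
  have hmeas : Measurable (prodPoly p) := by unfold prodPoly; fun_prop
  rw [memLp_two_iff_integrable_sq hmeas.aestronglyMeasurable]
  simp only [sq, prodPoly_mul]
  exact Integrable.fintype_prod (f := fun i x => (p i * p i).eval x)
    fun i => integrable_eval_gaussianReal (σ i) _

/-- `prodPoly p` as an element of `L²(N(0, diag σ))`. -/
noncomputable def prodPolyLp (σ : Fin d → ℝ≥0) (p : Fin d → ℝ[X]) : Lp ℝ 2 (diagGaussian σ) :=
  (memLp_prodPoly σ p).toLp (prodPoly p)

theorem inner_prodPolyLp_prodPolyLp (σ : Fin d → ℝ≥0) (p q : Fin d → ℝ[X]) :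
    ⟪prodPolyLp σ p, prodPolyLp σ q⟫_ℝ
      = ∏ i, ∫ x, (p i).eval x * (q i).eval x ∂gaussianReal 0 (σ i) := by
  calc ⟪prodPolyLp σ p, prodPolyLp σ q⟫_ℝ
      = ∫ x, prodPoly p x * prodPolyLp σ q x ∂diagGaussian σ := inner_toLp_eq_integral _ _
    _ = ∫ x, ∏ i, ((p i).eval (x i) * (q i).eval (x i)) ∂diagGaussian σ := by
        refine integral_congr_ae ((memLp_prodPoly σ q).coeFn_toLp.mono fun x hx => ?_)
        simp only [prodPolyLp, hx, prodPoly, prod_mul_distrib]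
    _ = _ := integral_fintype_prod_eq_prod (𝕜 := ℝ) fun i x => (p i).eval x * (q i).eval x

/-- The monomial `x ^ α` as an element of `L²(N(0, diag σ))`. -/
noncomputable def monomialLp (σ : Fin d → ℝ≥0) (α : Fin d → ℕ) : Lp ℝ 2 (diagGaussian σ) :=
  prodPolyLp σ fun i => X ^ α i

theorem inner_prodPolyLp_eq_sum {p : Fin d → ℝ[X]} {n : ℕ} (hp : ∀ i, (p i).natDegree ≤ n)
    (f : Lp ℝ 2 (diagGaussian σ)) :
    ⟪prodPolyLp σ p, f⟫_ℝ = ∑ α ∈ Fintype.piFinset fun _ => range (n + 1),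
      (∏ i, (p i).coeff (α i)) * ⟪monomialLp σ α, f⟫_ℝ := by
  simp only [monomialLp, prodPolyLp, inner_toLp_eq_integral, prodPoly_eq_sum hp, sum_mul, mul_assoc,
    ← integral_const_mul]
  exact integral_finsetSum _ fun α _ =>
    ((memLp_prodPoly σ _).integrable_mul (Lp.memLp f)).const_mul _

/-- The squared norm of the Hermite polynomial `∏ i, gaussHermite (σ i) (β i) (x i)`. -/
noncomputable def hermiteNormSq (σ : Fin d → ℝ≥0) (β : Fin d → ℕ) : ℝ :=
  ∏ i, (σ i : ℝ) ^ β i * (β i).factorial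

theorem hermiteNormSq_pos (hσ : ∀ i, 0 < σ i) (β : Fin d → ℕ) : 0 < hermiteNormSq σ β :=
  prod_pos fun i _ => mul_pos (pow_pos (hσ i) _) (by positivity)

/-- The normalized multivariate Hermite polynomials in `L²(N(0, diag σ))`. -/
noncomputable def hermiteLp (σ : Fin d → ℝ≥0) (β : Fin d → ℕ) : Lp ℝ 2 (diagGaussian σ) :=
  (√(hermiteNormSq σ β))⁻¹ • prodPolyLp σ fun i => gaussHermite (σ i) (β i)

theorem orthonormal_hermiteLp (hσ : ∀ i, 0 < σ i) : Orthonormal ℝ (hermiteLp σ) := by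
  classical
  rw [orthonormal_iff_ite]
  intro α β
  rw [hermiteLp, hermiteLp, inner_smul_left, inner_smul_right, conj_trivial,
    inner_prodPolyLp_prodPolyLp]
  simp only [integral_gaussHermite_mul]
  split_ifs with hαβ
  · subst hαβ
    have hN := hermiteNormSq_pos hσ α
    simp only [if_true]
    change _ * (_ * hermiteNormSq σ α) = 1
    rw [← mul_assoc, ← mul_inv, Real.mul_self_sqrt hN.le, inv_mul_cancel₀ hN.ne']
  · obtain ⟨i, hi⟩ := Function.ne_iff.1 hαβ
    rw [prod_eq_zero (mem_univ i) (if_neg hi), mul_zero, mul_zero]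

theorem inner_monomialLp_hermiteLp (σ : Fin d → ℝ≥0) (α β : Fin d → ℕ) :
    ⟪monomialLp σ α, hermiteLp σ β⟫_ℝ = (√(hermiteNormSq σ β))⁻¹ *
      ∏ i, (σ i : ℝ) ^ β i * ((α i).descFactorial (β i) *
        ∫ x, x ^ (α i - β i) ∂gaussianReal 0 (σ i)) := by
  rw [monomialLp, hermiteLp, inner_smul_right, inner_prodPolyLp_prodPolyLp]
  simp only [eval_pow, eval_X, integral_pow_mul_gaussHermite]

end GaussianL2

section FormBounds

open Polynomial

variable {d n : ℕ} {σ : Fin d → ℝ≥0} {a : ℕ → ℝ} {τ : ℝ}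

/-- The coefficient of `x ^ α * y ^ α` in the expansion of `∑ m, a m * ⟨x, y⟩ ^ m`. -/
noncomputable def kernelCoeff (a : ℕ → ℝ) (α : Fin d → ℕ) : ℝ :=
  a (∑ i, α i) * Nat.multinomial univ α

theorem kernelCoeff_nonneg (ha : ∀ m, 0 ≤ a m) (α : Fin d → ℕ) : 0 ≤ kernelCoeff a α :=
  mul_nonneg (ha _) (Nat.cast_nonneg _)

theorem prod_exp_const_mul_le {C : ℝ} (hC : 0 ≤ C) (hτ : ∑ i, (σ i : ℝ) ≤ τ) :
    ∏ i, Real.exp (C * σ i) ≤ Real.exp (C * τ) := by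
  rw [← Real.exp_sum, ← mul_sum]
  gcongr

theorem coe_le_of_sum_le (hτ : ∑ i, (σ i : ℝ) ≤ τ) (i : Fin d) : (σ i : ℝ) ≤ τ :=
  (single_le_sum (f := fun i => (σ i : ℝ)) (fun _ _ => NNReal.coe_nonneg _) (mem_univ i)).trans hτ

theorem sum_prod_parityWeight_right_le (hτ : ∑ i, (σ i : ℝ) ≤ τ) {β : Fin d → ℕ}
    (hβ : ∀ i, β i ≤ n) (J : Finset (Fin d → ℕ)) :
    ∑ α ∈ J, ∏ i, parityWeight (σ i) (β i) (α i)
      ≤ Real.exp ((∑ j ∈ range n, τ ^ j) * τ) := by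
  have hτ₀ : 0 ≤ τ := (sum_nonneg fun i _ => NNReal.coe_nonneg _).trans hτ
  refine (sum_prod_le_prod_of_sum_le J (fun i j => parityWeight_nonneg (NNReal.coe_nonneg _) _ j)
    fun i => ?_).trans (prod_exp_const_mul_le (sum_nonneg fun j _ => pow_nonneg hτ₀ j) hτ)
  obtain ⟨K, hKβ, hK⟩ := exists_sum_parityWeight_right_eq (σ i) (β i) (J.image (· i))
  rw [hK]
  exact sum_pow_le_exp_of_subset_range (NNReal.coe_nonneg _) (coe_le_of_sum_le hτ i)
    fun k hk => mem_range_succ_iff.2 ((hKβ k hk).trans (hβ i))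

theorem sum_prod_parityWeight_left_le (hτ : ∑ i, (σ i : ℝ) ≤ τ) {B : Finset (Fin d → ℕ)}
    (hB : ∀ β ∈ B, ∀ i, β i ≤ n) (α : Fin d → ℕ) :
    ∑ β ∈ B, ∏ i, parityWeight (σ i) (β i) (α i)
      ≤ Real.exp ((∑ j ∈ range n, τ ^ j) * τ) := by
  have hτ₀ : 0 ≤ τ := (sum_nonneg fun i _ => NNReal.coe_nonneg _).trans hτ
  refine (sum_prod_le_prod_of_sum_le (f := fun i b => parityWeight (σ i) b (α i)) B
    (fun i j => parityWeight_nonneg (NNReal.coe_nonneg _) j _) fun i => ?_).trans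
    (prod_exp_const_mul_le (sum_nonneg fun j _ => pow_nonneg hτ₀ j) hτ)
  obtain ⟨K, hKB, hK⟩ :=
    exists_sum_parityWeight_mul_left_eq (σ i) (α i) (B.image (· i)) fun _ => 1
  simp only [mul_one] at hK
  rw [hK]
  refine sum_pow_le_exp_of_subset_range (NNReal.coe_nonneg _) (coe_le_of_sum_le hτ i) fun k hk => ?_
  obtain ⟨β, hβ, hβk⟩ := mem_image.1 (hKB k hk)
  have := hB β hβ i
  exact mem_range_succ_iff.2 (by lia)

theorem prod_pow_mul_sq_coeff_le (hσ : ∀ i, 0 < σ i) (α β : Fin d → ℕ) :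
    (∏ i, (σ i : ℝ) ^ β i) *
        ((√(hermiteNormSq σ β))⁻¹ * ∏ i, (gaussHermite (σ i) (β i)).coeff (α i)) ^ 2
      ≤ 2 ^ (∑ i, β i) * (∏ i, parityWeight (σ i) (β i) (α i)) ^ 2 := by
  have hN := hermiteNormSq_pos hσ β
  rw [mul_pow, inv_pow, Real.sq_sqrt hN.le, mul_left_comm, inv_mul_le_iff₀ hN, hermiteNormSq,
    ← prod_pow_eq_pow_sum, ← prod_pow, ← prod_pow, ← prod_mul_distrib, ← prod_mul_distrib,
    ← prod_mul_distrib]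
  refine prod_le_prod (fun i _ => by positivity) fun i _ => ?_
  calc (σ i : ℝ) ^ β i * (gaussHermite (σ i) (β i)).coeff (α i) ^ 2
      ≤ (σ i : ℝ) ^ β i * (2 ^ β i * (β i).factorial * parityWeight (σ i) (β i) (α i) ^ 2) := by
        gcongr
        exact sq_coeff_gaussHermite_le _ _
    _ = _ := by ring

theorem le_kernelCoeff_or_prod_parityWeight_eq_zero {δ : ℝ} (hδ : 0 ≤ δ) (κ : Fin d → ℝ)
    (α β : Fin d → ℕ) (hδa : ∀ m ≤ ∑ i, β i, m ≡ ∑ i, β i [MOD 2] → δ ≤ a m) :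
    δ ≤ kernelCoeff a α ∨ ∏ i, parityWeight (κ i) (β i) (α i) = 0 := by
  by_cases! hk : ∀ i, ∃ k, β i = α i + 2 * k
  · choose k hk using hk
    have hsum : ∑ i, β i = ∑ i, α i + 2 * ∑ i, k i := by
      simp only [hk, sum_add_distrib, mul_sum]
    have ha : δ ≤ a (∑ i, α i) := hδa _ (by lia) (by rw [hsum]; simp [Nat.ModEq])
    exact .inl (ha.trans (le_mul_of_one_le_right (hδ.trans ha)
      (mod_cast Nat.multinomial_pos univ α)))
  · obtain ⟨i, hi⟩ := hk
    exact .inr (prod_eq_zero (mem_univ i)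
      ((eq_add_two_mul_or_parityWeight_eq_zero (κ i) (β i) (α i)).resolve_left fun ⟨k, h⟩ =>
        hi k h))

theorem sum_prod_pow_mul_inner_hermiteLp_sq_le (hσ : ∀ i, 0 < σ i) (hτ : ∑ i, (σ i : ℝ) ≤ τ)
    {δ : ℝ} (hδ : 0 < δ) (ha : ∀ m, 0 ≤ a m) (hδa : ∀ m ≤ n, m ≡ n [MOD 2] → δ ≤ a m)
    {B : Finset (Fin d → ℕ)} (hB : ∀ β ∈ B, ∑ i, β i = n) (f : Lp ℝ 2 (diagGaussian σ)) :
    ∑ β ∈ B, (∏ i, (σ i : ℝ) ^ β i) * ⟪hermiteLp σ β, f⟫_ℝ ^ 2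
      ≤ Real.exp ((∑ j ∈ range n, τ ^ j) * τ) *
          (2 ^ n * δ⁻¹ * Real.exp ((∑ j ∈ range n, τ ^ j) * τ)) *
        ∑ α ∈ Fintype.piFinset fun _ => range (n + 1),
          kernelCoeff a α * ⟪monomialLp σ α, f⟫_ℝ ^ 2 := by
  have hle (β) (hβ : β ∈ B) (i : Fin d) : β i ≤ n :=
    hB β hβ ▸ single_le_sum (f := β) (fun _ _ => Nat.zero_le _) (mem_univ i)
  have hp (β α : Fin d → ℕ) : 0 ≤ ∏ i, parityWeight (σ i) (β i) (α i) :=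
    prod_nonneg fun i _ => parityWeight_nonneg (NNReal.coe_nonneg _) _ _
  have hexpand (β) (hβ : β ∈ B) : ⟪hermiteLp σ β, f⟫_ℝ =
      ∑ α ∈ Fintype.piFinset fun _ => range (n + 1), ((√(hermiteNormSq σ β))⁻¹ *
        ∏ i, (gaussHermite (σ i) (β i)).coeff (α i)) * ⟪monomialLp σ α, f⟫_ℝ := by
    rw [hermiteLp, inner_smul_left, conj_trivial, inner_prodPolyLp_eq_sum (n := n)
      fun i => (natDegree_gaussHermite_le _ _).trans (hle β hβ i), mul_sum]
    simp only [mul_assoc]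
  rw [sum_congr rfl fun β hβ => by rw [hexpand β hβ]]
  refine sum_mul_sq_sum_mul_le (p := fun β α => ∏ i, parityWeight (σ i) (β i) (α i))
    (q := fun β α => 2 ^ n * δ⁻¹ * ∏ i, parityWeight (σ i) (β i) (α i))
    (fun β => prod_nonneg fun i _ => by positivity) (kernelCoeff_nonneg ha) hp
    (fun β α => mul_nonneg (by positivity) (hp β α)) (fun β hβ α _ => ?_) (Real.exp_nonneg _)
    (fun β hβ => sum_prod_parityWeight_right_le hτ (hle β hβ) _) (fun α _ => ?_) _
  · refine (prod_pow_mul_sq_coeff_le hσ α β).trans ?_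
    rw [hB β hβ]
    rcases le_kernelCoeff_or_prod_parityWeight_eq_zero hδ.le (fun i => (σ i : ℝ)) α β
      (by rwa [hB β hβ]) with hw | h0
    · have hone : 1 ≤ δ⁻¹ * kernelCoeff a α := by rwa [← div_eq_inv_mul, one_le_div hδ]
      calc _ ≤ 2 ^ n * (∏ i, parityWeight (σ i) (β i) (α i)) ^ 2 * (δ⁻¹ * kernelCoeff a α) :=
            le_mul_of_one_le_right (by positivity) hone
        _ = _ := by ring
    · simp [h0]
  · rw [← mul_sum]
    gcongr
    exact sum_prod_parityWeight_left_le hτ hle α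

theorem pow_mul_sq_integral_gaussHermite_le (s : ℝ≥0) {r : ℝ} (hr : 0 ≤ r) (m b : ℕ) :
    r ^ m * (s ^ b * (m.descFactorial b * ∫ x, x ^ (m - b) ∂gaussianReal 0 s)) ^ 2
      ≤ m.factorial * (s ^ b * b.factorial) * ((r * s) ^ b *
        (parityWeight (r * s) m b * (parityWeight (r * s) m b * m.choose b))) := by
  rcases lt_or_ge m b with hmb | hmb
  · rw [Nat.descFactorial_of_lt hmb]
    simp only [CharP.cast_eq_zero, zero_mul, mul_zero, zero_pow two_ne_zero]
    positivity [parityWeight_nonneg (mul_nonneg hr s.coe_nonneg) m b]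
  obtain ⟨l, rfl⟩ := Nat.exists_eq_add_of_le hmb
  rw [Nat.add_sub_cancel_left]
  rcases l.even_or_odd' with ⟨k, rfl | rfl⟩
  · rw [parityWeight_add_two_mul, Nat.descFactorial_eq_factorial_mul_choose,
      ← Nat.choose_mul_factorial_mul_factorial (Nat.le_add_right b (2 * k)),
      Nat.add_sub_cancel_left]
    push_cast
    calc r ^ (b + 2 * k) * (s ^ b * (b.factorial * (b + 2 * k).choose b *
          ∫ x, x ^ (2 * k) ∂gaussianReal 0 s)) ^ 2
        = r ^ (b + 2 * k) * (s ^ b * (b.factorial * (b + 2 * k).choose b)) ^ 2 *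
          (∫ x, x ^ (2 * k) ∂gaussianReal 0 s) ^ 2 := by ring
      _ ≤ r ^ (b + 2 * k) * (s ^ b * (b.factorial * (b + 2 * k).choose b)) ^ 2 *
          (s ^ (2 * k) * (2 * k).factorial) := by
        gcongr
        exact sq_integral_pow_gaussianReal_le s _
      _ = _ := by ring
  · rw [integral_pow_gaussianReal_of_odd s (odd_two_mul_add_one k)]
    have := parityWeight_nonneg (mul_nonneg hr s.coe_nonneg) (b + (2 * k + 1)) b
    simp only [mul_zero, zero_pow two_ne_zero]
    positivity

theorem kernelCoeff_mul_inner_sq_le (hσ : ∀ i, 0 < σ i) {M r : ℝ} (hM : 0 ≤ M) (hr : 0 ≤ r)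
    {α : Fin d → ℕ} (haM : a (∑ i, α i) * (∑ i, α i).factorial ≤ M * r ^ (∑ i, α i))
    (β : Fin d → ℕ) :
    kernelCoeff a α * ⟪monomialLp σ α, hermiteLp σ β⟫_ℝ ^ 2
      ≤ M * ∏ i, (r * σ i) ^ β i * (parityWeight (r * σ i) (α i) (β i) *
        (parityWeight (r * σ i) (α i) (β i) * (α i).choose (β i))) := by
  have hN := hermiteNormSq_pos hσ β
  have hfac : (0 : ℝ) < ∏ i, ((α i).factorial : ℝ) := prod_pos fun i _ => by positivity
  have hcoeff : kernelCoeff a α ≤ M * (∏ i, r ^ α i) / ∏ i, ((α i).factorial : ℝ) := by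
    rw [le_div_iff₀ hfac, prod_pow_eq_pow_sum]
    refine le_trans (le_of_eq ?_) haM
    rw [kernelCoeff, mul_assoc, ← Nat.multinomial_spec]
    push_cast
    ring
  rw [inner_monomialLp_hermiteLp, mul_pow, inv_pow, Real.sq_sqrt hN.le, ← prod_pow]
  refine (mul_le_mul_of_nonneg_right hcoeff (by positivity)).trans ?_
  rw [div_mul_eq_mul_div, div_le_iff₀ hfac, mul_left_comm, inv_mul_le_iff₀ hN, mul_assoc M,
    ← prod_mul_distrib, mul_left_comm, mul_assoc, mul_comm (hermiteNormSq σ β)]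
  gcongr
  rw [hermiteNormSq, ← prod_mul_distrib, ← prod_mul_distrib]
  refine prod_le_prod (fun i _ => by positivity) fun i _ => ?_
  exact (pow_mul_sq_integral_gaussHermite_le (σ i) hr (α i) (β i)).trans_eq (by ring)

theorem sum_prod_parityWeight_right_le_exp (hτ : ∑ i, (σ i : ℝ) ≤ τ) {r : ℝ} (hr : 0 ≤ r)
    (hrσ : ∀ i, r * σ i ≤ 3 / 5) (α : Fin d → ℕ) (B : Finset (Fin d → ℕ)) :
    ∑ β ∈ B, ∏ i, parityWeight (r * σ i) (α i) (β i) ≤ Real.exp (25 * r * τ) := by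
  have hκ (i : Fin d) : 0 ≤ r * σ i := mul_nonneg hr (NNReal.coe_nonneg _)
  refine (sum_prod_le_prod_of_sum_le (f := fun i b => parityWeight (r * σ i) (α i) b) B
    (fun i b => parityWeight_nonneg (hκ i) _ b) fun i =>
    sum_parityWeight_right_le_exp (hκ i) (hrσ i) _ _).trans ?_
  simp only [← mul_assoc]
  exact prod_exp_const_mul_le (by positivity) hτ

theorem sum_prod_parityWeight_mul_choose_le_exp (hτ : ∑ i, (σ i : ℝ) ≤ τ) {r : ℝ} (hr : 0 ≤ r)
    (hrσ : ∀ i, r * σ i ≤ 3 / 5) (β : Fin d → ℕ) (I : Finset (Fin d → ℕ)) :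
    ∑ α ∈ I, ∏ i, parityWeight (r * σ i) (α i) (β i) * (α i).choose (β i)
      ≤ 5 ^ (∑ i, β i) * Real.exp (25 * r * τ) := by
  have hκ (i : Fin d) : 0 ≤ r * σ i := mul_nonneg hr (NNReal.coe_nonneg _)
  refine (sum_prod_le_prod_of_sum_le
    (f := fun i m => parityWeight (r * σ i) m (β i) * m.choose (β i)) I
    (fun i m => mul_nonneg (parityWeight_nonneg (hκ i) _ _) (Nat.cast_nonneg _)) fun i =>
    sum_parityWeight_mul_choose_le_exp (hκ i) (hrσ i) _ _).trans ?_
  rw [prod_mul_distrib, prod_pow_eq_pow_sum]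
  simp only [← mul_assoc]
  gcongr
  exact prod_exp_const_mul_le (by positivity) hτ

theorem sum_kernelCoeff_mul_inner_sum_sq_le (hσ : ∀ i, 0 < σ i) (hτ : ∑ i, (σ i : ℝ) ≤ τ)
    (ha : ∀ m, 0 ≤ a m) {M r : ℝ} (hM : 0 ≤ M) (hr : 0 ≤ r) (hrσ : ∀ i, r * σ i ≤ 3 / 5)
    (haM : ∀ α : Fin d → ℕ, a (∑ i, α i) * (∑ i, α i).factorial ≤ M * r ^ (∑ i, α i))
    {B : Finset (Fin d → ℕ)} (hB : ∀ β ∈ B, ∑ i, β i = n) (I : Finset (Fin d → ℕ))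
    (x : (Fin d → ℕ) → ℝ) :
    ∑ α ∈ I, kernelCoeff a α * ⟪monomialLp σ α, ∑ β ∈ B, x β • hermiteLp σ β⟫_ℝ ^ 2
      ≤ M * r ^ n * (Real.exp (25 * r * τ) * (5 ^ n * Real.exp (25 * r * τ))) *
        ∑ β ∈ B, (∏ i, (σ i : ℝ) ^ β i) * x β ^ 2 := by
  have hpw (i : Fin d) (m b : ℕ) : 0 ≤ parityWeight (r * σ i) m b :=
    parityWeight_nonneg (mul_nonneg hr (NNReal.coe_nonneg _)) m b
  have hw (β : Fin d → ℕ) : 0 ≤ M * r ^ n * ∏ i, (σ i : ℝ) ^ β i := by positivity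
  simp only [inner_sum, inner_smul_right, mul_comm (x _)]
  refine (sum_mul_sq_sum_mul_le (p := fun α β => ∏ i, parityWeight (r * σ i) (α i) (β i))
    (q := fun α β => ∏ i, parityWeight (r * σ i) (α i) (β i) * (α i).choose (β i))
    (w := fun β => M * r ^ n * ∏ i, (σ i : ℝ) ^ β i)
    (Q := 5 ^ n * Real.exp (25 * r * τ)) (kernelCoeff_nonneg ha)
    hw (fun α β => prod_nonneg fun i _ => hpw i _ _)
    (fun α β => prod_nonneg fun i _ => mul_nonneg (hpw i _ _) (Nat.cast_nonneg _))
    (fun α _ β hβ => ?_) (Real.exp_nonneg _)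
    (fun α _ => sum_prod_parityWeight_right_le_exp hτ hr hrσ α B) (fun β hβ => ?_) x).trans_eq ?_
  · refine (kernelCoeff_mul_inner_sq_le hσ hM hr (haM α) β).trans_eq ?_
    simp only [mul_pow, prod_mul_distrib, prod_pow_eq_pow_sum, hB β hβ]
    ring
  · exact hB β hβ ▸ sum_prod_parityWeight_mul_choose_le_exp hτ hr hrσ β I
  · simp only [mul_assoc, ← mul_sum]
    ring

end FormBounds

section InnerProductKernel

open Polynomial

variable {h : ℝ → ℝ} {a : ℕ → ℝ} {d : ℕ} {σ : Fin d → ℝ≥0}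

theorem tendsto_eLpNorm_zero_of_dominated {X E : Type*} [MeasurableSpace X] {μ : Measure X}
    [NormedAddCommGroup E] {p : ℝ≥0∞} (hp₀ : p ≠ 0) (hp : p ≠ ⊤) {F : ℕ → X → E} {G : X → ℝ}
    (hF : ∀ n, AEStronglyMeasurable (F n) μ) (hG : MemLp G p μ) (hFG : ∀ n x, ‖F n x‖ ≤ G x)
    (hlim : ∀ x, Tendsto (fun n => F n x) atTop (𝓝 0)) :
    Tendsto (fun n => eLpNorm (F n) p μ) atTop (𝓝 0) := by
  have hp' : 0 < p.toReal := ENNReal.toReal_pos hp₀ hp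
  have hlintegral : Tendsto (fun n => ∫⁻ x, ‖F n x‖ₑ ^ p.toReal ∂μ) atTop (𝓝 0) := by
    rw [← lintegral_zero (μ := μ)]
    refine tendsto_lintegral_of_dominated_convergence' (fun x => ‖G x‖ₑ ^ p.toReal)
      (fun n => (hF n).enorm.pow_const _) (fun n => .of_forall fun x => ?_)
      (lintegral_rpow_enorm_lt_top_of_eLpNorm_lt_top hp₀ hp hG.2).ne (.of_forall fun x => ?_)
    · refine ENNReal.rpow_le_rpow ?_ hp'.le
      exact enorm_le_iff_norm_le.2 ((hFG n x).trans (Real.le_norm_self _))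
    · simpa [ENNReal.zero_rpow_of_pos hp', Function.comp_def] using
        (ENNReal.continuous_rpow_const (y := p.toReal)).tendsto _ |>.comp (hlim x).enorm
  simp only [eLpNorm_eq_lintegral_rpow_enorm_toReal hp₀ hp]
  simpa [ENNReal.zero_rpow_of_pos, hp', Function.comp_def] using
    (ENNReal.continuous_rpow_const (y := 1 / p.toReal)).tendsto _ |>.comp hlintegral

theorem measurePreserving_neg_diagGaussian (σ : Fin d → ℝ≥0) :
    MeasurePreserving (fun x : Fin d → ℝ => -x) (diagGaussian σ) (diagGaussian σ) := by
  refine measurePreserving_pi (f := fun _ (x : ℝ) => -x) _ _ fun i => ⟨measurable_neg, ?_⟩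
  rw [gaussianReal_map_neg, neg_zero]

theorem IsNonnegSeries.abs_sub_sum_le (hh : IsNonnegSeries h a) (N : ℕ) (t : ℝ) :
    |h t - ∑ m ∈ range N, a m * t ^ m| ≤ |h t| + |h (-t)| := by
  have htail : |h t - ∑ m ∈ range N, a m * t ^ m| ≤ h |t| - ∑ m ∈ range N, a m * |t| ^ m := by
    rw [← Real.norm_eq_abs]
    refine ((hasSum_nat_add_iff' N).2 (hh.hasSum t)).norm_le_of_bounded
      ((hasSum_nat_add_iff' N).2 (hh.hasSum |t|)) fun m => ?_
    rw [norm_mul, norm_pow, Real.norm_of_nonneg (hh.nonneg _), Real.norm_eq_abs]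
  have hhead : 0 ≤ ∑ m ∈ range N, a m * |t| ^ m :=
    sum_nonneg fun m _ => mul_nonneg (hh.nonneg m) (by positivity)
  refine (htail.trans (sub_le_self _ hhead)).trans ((le_abs_self _).trans ?_)
  rcases abs_choice t with ht | ht <;> rw [ht]
  · exact le_add_of_nonneg_right (abs_nonneg _)
  · exact le_add_of_nonneg_left (abs_nonneg _)

/-- The multi-indices of degree less than `N`. -/
def multiIndicesBelow (d N : ℕ) : Finset (Fin d → ℕ) :=
  (range N).biUnion fun m => piAntidiag univ m

theorem mem_multiIndicesBelow {N : ℕ} {α : Fin d → ℕ} :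
    α ∈ multiIndicesBelow d N ↔ ∑ i, α i < N := by
  simp [multiIndicesBelow]

theorem tendsto_multiIndicesBelow (d : ℕ) : Tendsto (multiIndicesBelow d) atTop atTop :=
  tendsto_atTop_finset_of_monotone
    (fun _ _ hNM _ hα => mem_multiIndicesBelow.2 ((mem_multiIndicesBelow.1 hα).trans_le hNM))
    fun _ => ⟨_, mem_multiIndicesBelow.2 (Nat.lt_succ_self _)⟩

theorem sum_multiIndicesBelow_kernelCoeff_mul (a : ℕ → ℝ) (N : ℕ) (x y : Fin d → ℝ) :
    ∑ α ∈ multiIndicesBelow d N,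
        kernelCoeff a α * (prodPoly (fun i => X ^ α i) x * prodPoly (fun i => X ^ α i) y)
      = ∑ m ∈ range N, a m * (∑ i, x i * y i) ^ m := by
  rw [multiIndicesBelow, sum_biUnion]
  · refine sum_congr rfl fun m _ => ?_
    rw [sum_pow_eq_sum_piAntidiag, mul_sum]
    refine sum_congr rfl fun α hα => ?_
    simp only [kernelCoeff, (mem_piAntidiag.1 hα).1, prodPoly, eval_pow, eval_X,
      ← prod_mul_distrib, mul_pow, mul_assoc]
  · intro m _ m' _ hne
    refine disjoint_left.2 fun α hα hα' => hne ?_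
    rw [← (mem_piAntidiag.1 hα).1, ← (mem_piAntidiag.1 hα').1]

/-- The truncation of `innerProductKernel` to degree less than `N`, written in monomials. -/
noncomputable def truncatedKernel (a : ℕ → ℝ) (d N : ℕ) (x y : Fin d → ℝ) : ℝ :=
  ∑ α ∈ multiIndicesBelow d N,
    kernelCoeff a α * (prodPoly (fun i => X ^ α i) x * prodPoly (fun i => X ^ α i) y)

theorem isHilbertSchmidtKernel_truncatedKernel (a : ℕ → ℝ) (σ : Fin d → ℝ≥0) (N : ℕ) :
    IsHilbertSchmidtKernel (truncatedKernel a d N) (diagGaussian σ) :=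
  memLp_finsetSum _ fun α _ => MemLp.const_mul
    (isHilbertSchmidtKernel_mul (memLp_prodPoly σ fun i => X ^ α i) (memLp_prodPoly σ _)) _

theorem tendsto_eLpNorm_sub_truncatedKernel (hh : IsNonnegSeries h a)
    (hk : IsHilbertSchmidtKernel (innerProductKernel h d) (diagGaussian σ)) :
    Tendsto (fun N => eLpNorm (fun p : (Fin d → ℝ) × (Fin d → ℝ) =>
      innerProductKernel h d p.1 p.2 - truncatedKernel a d N p.1 p.2) 2
      ((diagGaussian σ).prod (diagGaussian σ))) atTop (𝓝 0) := by
  -- Flipping the sign of `y` maps `h ⟨x, y⟩` to `h (-⟨x, y⟩)` and preserves the product measure.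
  have hflip : MemLp (fun p : (Fin d → ℝ) × (Fin d → ℝ) => innerProductKernel h d p.1 (-p.2)) 2
      ((diagGaussian σ).prod (diagGaussian σ)) :=
    MemLp.comp_measurePreserving (g := fun p : _ × _ => innerProductKernel h d p.1 p.2) hk
      ((MeasurePreserving.id _).prod (measurePreserving_neg_diagGaussian σ))
  refine tendsto_eLpNorm_zero_of_dominated two_ne_zero ENNReal.ofNat_ne_top
    (fun N => (hk.sub (isHilbertSchmidtKernel_truncatedKernel a σ N)).1)
    ((MemLp.abs hk).add hflip.abs) (fun N p => ?_) fun p => ?_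
  · simpa [innerProductKernel, truncatedKernel, sum_multiIndicesBelow_kernelCoeff_mul] using
      hh.abs_sub_sum_le N (∑ i, p.1 i * p.2 i)
  · simpa [innerProductKernel, truncatedKernel, sum_multiIndicesBelow_kernelCoeff_mul] using
      ((hh.hasSum (∑ i, p.1 i * p.2 i)).tendsto_sum_nat).const_sub (h (∑ i, p.1 i * p.2 i))

theorem tendsto_sum_rankOne_monomialLp (hh : IsNonnegSeries h a)
    (hk : IsHilbertSchmidtKernel (innerProductKernel h d) (diagGaussian σ)) :
    Tendsto (fun N => ∑ α ∈ multiIndicesBelow d N, kernelCoeff a α •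
      InnerProductSpace.rankOne ℝ (monomialLp σ α) (monomialLp σ α)) atTop (𝓝 hk.toCLM) := by
  refine (hk.tendsto_toCLM (isHilbertSchmidtKernel_truncatedKernel a σ)
    (tendsto_eLpNorm_sub_truncatedKernel hh hk)).congr fun N => ?_
  exact IsHilbertSchmidtKernel.toCLM_sum_mul (fun α => memLp_prodPoly σ _) _ _ _

theorem isCompactOperator_toCLM_innerProductKernel (hh : IsNonnegSeries h a)
    (hk : IsHilbertSchmidtKernel (innerProductKernel h d) (diagGaussian σ)) :
    IsCompactOperator hk.toCLM :=
  isCompactOperator_of_tendsto (tendsto_sum_rankOne_monomialLp hh hk)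
    (.of_forall fun _ => isCompactOperator_sum_rankOne _ _ _)

theorem isSymmetric_toCLM_innerProductKernel (hh : IsNonnegSeries h a)
    (hk : IsHilbertSchmidtKernel (innerProductKernel h d) (diagGaussian σ)) :
    (hk.toCLM : Lp ℝ 2 (diagGaussian σ) →ₗ[ℝ] Lp ℝ 2 (diagGaussian σ)).IsSymmetric :=
  isSymmetric_of_tendsto_sum_rankOne (tendsto_sum_rankOne_monomialLp hh hk)

theorem hasSum_kernelCoeff_mul_inner_sq (hh : IsNonnegSeries h a)
    (hk : IsHilbertSchmidtKernel (innerProductKernel h d) (diagGaussian σ))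
    (f : Lp ℝ 2 (diagGaussian σ)) :
    HasSum (fun α => kernelCoeff a α * ⟪monomialLp σ α, f⟫_ℝ ^ 2) ⟪hk.toCLM f, f⟫_ℝ :=
  hasSum_of_tendsto_sum_rankOne (kernelCoeff_nonneg hh.nonneg) (tendsto_multiIndicesBelow d)
    (tendsto_sum_rankOne_monomialLp hh hk) f

theorem kernelCoeff_mul_inner_sq_le_inner_toCLM (hh : IsNonnegSeries h a)
    (hk : IsHilbertSchmidtKernel (innerProductKernel h d) (diagGaussian σ))
    (f : Lp ℝ 2 (diagGaussian σ)) (α : Fin d → ℕ) :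
    kernelCoeff a α * ⟪monomialLp σ α, f⟫_ℝ ^ 2 ≤ ⟪hk.toCLM f, f⟫_ℝ :=
  le_hasSum (hasSum_kernelCoeff_mul_inner_sq hh hk f) α fun α _ =>
    mul_nonneg (kernelCoeff_nonneg hh.nonneg α) (sq_nonneg _)

theorem inner_toCLM_innerProductKernel_nonneg (hh : IsNonnegSeries h a)
    (hk : IsHilbertSchmidtKernel (innerProductKernel h d) (diagGaussian σ))
    (f : Lp ℝ 2 (diagGaussian σ)) : 0 ≤ ⟪hk.toCLM f, f⟫_ℝ :=
  (hasSum_kernelCoeff_mul_inner_sq hh hk f).nonneg fun α =>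
    mul_nonneg (kernelCoeff_nonneg hh.nonneg α) (sq_nonneg _)

end InnerProductKernel

section GrowthBound

open Polynomial

variable {h : ℝ → ℝ} {a : ℕ → ℝ} {τ : ℝ}

theorem factorial_mul_pow_le_integral_pow_gaussianReal (v : ℝ≥0) (m : ℕ) :
    m.factorial * (2 * (v : ℝ)) ^ m ≤ (2 * m + 1) * ∫ x, x ^ (2 * m) ∂gaussianReal 0 v := by
  induction m with
  | zero => simp
  | succ m ih =>
    have hmoment : 0 ≤ ∫ x, x ^ (2 * m) ∂gaussianReal 0 v :=
      integral_nonneg fun x => (even_two_mul m).pow_nonneg x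
    calc ((m + 1).factorial : ℝ) * (2 * (v : ℝ)) ^ (m + 1)
        = (2 * m + 2) * v * (m.factorial * (2 * (v : ℝ)) ^ m) := by
          push_cast [Nat.factorial_succ]
          ring
      _ ≤ (2 * m + 2) * v * ((2 * m + 1) * ∫ x, x ^ (2 * m) ∂gaussianReal 0 v) := by gcongr
      _ = (2 * m + 2) * (v * (2 * m + 1) * ∫ x, x ^ (2 * m) ∂gaussianReal 0 v) := by ring
      _ ≤ (2 * m + 3) * (v * (2 * m + 1) * ∫ x, x ^ (2 * m) ∂gaussianReal 0 v) := by
          gcongr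
          norm_num
      _ = _ := by
          rw [Nat.mul_succ, integral_pow_add_two_gaussianReal]
          push_cast
          ring

theorem mul_sq_norm_le_opNorm {H : Type*} [NormedAddCommGroup H] [InnerProductSpace ℝ H]
    {T : H →L[ℝ] H} {u : H} {c : ℝ} (hc : c * ⟪u, u⟫_ℝ ^ 2 ≤ ⟪T u, u⟫_ℝ) :
    c * ⟪u, u⟫_ℝ ≤ ‖T‖ := by
  rcases eq_or_ne u 0 with rfl | hu
  · simp
  · refine le_of_mul_le_mul_right ?_ (real_inner_self_pos.2 hu)
    calc c * ⟪u, u⟫_ℝ * ⟪u, u⟫_ℝ = c * ⟪u, u⟫_ℝ ^ 2 := by ring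
      _ ≤ ⟪T u, u⟫_ℝ := hc
      _ ≤ ‖T u‖ * ‖u‖ := real_inner_le_norm _ _
      _ ≤ ‖T‖ * ‖u‖ * ‖u‖ := by
          gcongr
          exact T.le_opNorm u
      _ = ‖T‖ * ⟪u, u⟫_ℝ := by rw [mul_assoc, real_inner_self_eq_norm_mul_norm]

theorem coeff_mul_integral_pow_le_norm_toCLM {d : ℕ} {σ : Fin d → ℝ≥0} (hh : IsNonnegSeries h a)
    (hk : IsHilbertSchmidtKernel (innerProductKernel h d) (diagGaussian σ)) (i : Fin d) (m : ℕ) :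
    a m * ∫ x, x ^ (2 * m) ∂gaussianReal 0 (σ i) ≤ ‖hk.toCLM‖ := by
  have hcoeff : kernelCoeff a (Pi.single i m : Fin d → ℕ) = a m := by
    simp [kernelCoeff, Nat.multinomial_single]
  have hnorm : ⟪monomialLp σ (Pi.single i m), monomialLp σ (Pi.single i m)⟫_ℝ
      = ∫ x, x ^ (2 * m) ∂gaussianReal 0 (σ i) := by
    rw [monomialLp, inner_prodPolyLp_prodPolyLp, prod_eq_single i]
    · simp [← pow_add, ← two_mul]
    · intro j _ hj
      simp [hj]
    · simp
  rw [← hcoeff, ← hnorm]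
  exact mul_sq_norm_le_opNorm (kernelCoeff_mul_inner_sq_le_inner_toCLM hh hk _ _)

/-- The variances in `(0, τ]` that can occur in a Gaussian measure for which the inner-product
kernel with coefficients `a` is Hilbert-Schmidt. -/
def admissibleVariances (a : ℕ → ℝ) (τ : ℝ) : Set ℝ≥0 :=
  {s | 0 < s ∧ s ≤ τ ∧ BddAbove (Set.range fun m => a m * ∫ x, x ^ (2 * m) ∂gaussianReal 0 s)}

theorem mem_admissibleVariances {d : ℕ} {σ : Fin d → ℝ≥0} (hh : IsNonnegSeries h a)
    (hσ : ∀ i, 0 < σ i) (hτ : ∑ i, (σ i : ℝ) ≤ τ)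
    (hk : IsHilbertSchmidtKernel (innerProductKernel h d) (diagGaussian σ)) (i : Fin d) :
    σ i ∈ admissibleVariances a τ :=
  ⟨hσ i, coe_le_of_sum_le hτ i, ‖hk.toCLM‖, by
    rintro _ ⟨m, rfl⟩
    exact coeff_mul_integral_pow_le_norm_toCLM hh hk i m⟩

theorem exists_mem_forall_mul_le {S : Set ℝ≥0} (hS : S.Nonempty) (hbdd : BddAbove S) {q : ℝ≥0}
    (hq : q < 1) : ∃ s₀ ∈ S, ∀ s ∈ S, q * s ≤ s₀ := by
  rcases eq_zero_or_pos (sSup S) with hzero | hpos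
  · obtain ⟨s₀, hs₀⟩ := hS
    refine ⟨s₀, hs₀, fun s hs => ?_⟩
    have hs0 : s = 0 := le_zero_iff.1 (hzero ▸ le_csSup hbdd hs)
    simp [hs0]
  · obtain ⟨s₀, hs₀, hlt⟩ := exists_lt_of_lt_csSup hS (mul_lt_of_lt_one_left hpos hq)
    exact ⟨s₀, hs₀, fun s hs => (mul_le_mul_right (le_csSup hbdd hs) q).trans hlt.le⟩

theorem exists_growth_bound_of_nonempty (ha : ∀ m, 0 ≤ a m)
    (hne : (admissibleVariances a τ).Nonempty) :
    ∃ M r : ℝ, 0 ≤ M ∧ 0 ≤ r ∧ (∀ m, a m * m.factorial ≤ M * r ^ m) ∧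
      ∀ s ∈ admissibleVariances a τ, r * s ≤ 3 / 5 := by
  have hbdd : BddAbove (admissibleVariances a τ) := ⟨τ.toNNReal, fun s hs =>
    NNReal.le_toNNReal_of_coe_le hs.2.1⟩
  obtain ⟨s₀, ⟨hs₀, -, C, hC⟩, hmax⟩ := exists_mem_forall_mul_le hne hbdd (q := 11 / 12)
    (by rw [div_lt_one (by norm_num)]; norm_num)
  replace hC (m : ℕ) : a m * ∫ x, x ^ (2 * m) ∂gaussianReal 0 s₀ ≤ C := hC ⟨m, rfl⟩
  have hC₀ : 0 ≤ C := (ha 0).trans (by simpa using hC 0)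
  have hs₀' : (0 : ℝ) < s₀ := hs₀
  have hratio : 11 / (20 * s₀) * (2 * (s₀ : ℝ)) = 1 + 1 / 10 := by
    field_simp
    norm_num
  -- With `r = 11 / (20 * s₀)`, the factor `2 * m + 1` is absorbed since `2 * s₀ * r > 1`, while
  -- `r * s ≤ 3 / 5` because `s₀` is nearly maximal.
  refine ⟨20 * C, 11 / (20 * s₀), by positivity, by positivity, fun m => ?_, fun s hs => ?_⟩
  · refine le_of_mul_le_mul_right ?_ (pow_pos (mul_pos two_pos hs₀') m)
    calc a m * m.factorial * (2 * s₀) ^ m = a m * (m.factorial * (2 * (s₀ : ℝ)) ^ m) := by ring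
      _ ≤ a m * ((2 * m + 1) * ∫ x, x ^ (2 * m) ∂gaussianReal 0 s₀) :=
          mul_le_mul_of_nonneg_left (factorial_mul_pow_le_integral_pow_gaussianReal s₀ m) (ha m)
      _ = (a m * ∫ x, x ^ (2 * m) ∂gaussianReal 0 s₀) * (2 * m + 1) := by ring
      _ ≤ C * (20 * (1 + m * (1 / 10))) :=
          mul_le_mul (hC m) (by linarith) (by positivity) hC₀
      _ ≤ C * (20 * (1 + 1 / 10) ^ m) := by
          gcongr
          exact one_add_mul_le_pow (by norm_num) m
      _ = 20 * C * (11 / (20 * s₀)) ^ m * (2 * s₀) ^ m := by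
          rw [mul_assoc (20 * C), ← mul_pow, hratio]
          ring
  · have hle : (11 / 12 : ℝ) * s ≤ s₀ := by exact_mod_cast hmax s hs
    rw [div_mul_eq_mul_div, div_le_iff₀ (by positivity)]
    linarith

theorem exists_growth_bound (hh : IsNonnegSeries h a) (τ : ℝ) :
    ∃ M r : ℝ, 0 ≤ M ∧ 0 ≤ r ∧ ∀ {d : ℕ} {σ : Fin d → ℝ≥0}, (∀ i, 0 < σ i) →
      ∑ i, (σ i : ℝ) ≤ τ → IsHilbertSchmidtKernel (innerProductKernel h d) (diagGaussian σ) →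
      (∀ i, r * σ i ≤ 3 / 5) ∧
        ∀ α : Fin d → ℕ, a (∑ i, α i) * (∑ i, α i).factorial ≤ M * r ^ ∑ i, α i := by
  rcases (admissibleVariances a τ).eq_empty_or_nonempty with hempty | hne
  · refine ⟨a 0, 0, hh.nonneg 0, le_rfl, fun {d σ} hσ hτ hk => ?_⟩
    have : IsEmpty (Fin d) := ⟨fun i => by
      simpa [hempty] using mem_admissibleVariances hh hσ hτ hk i⟩
    simp
  · obtain ⟨M, r, hM, hr, ha, hrs⟩ := exists_growth_bound_of_nonempty hh.nonneg hne
    exact ⟨M, r, hM, hr, fun hσ hτ hk =>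
      ⟨fun i => hrs _ (mem_admissibleVariances hh hσ hτ hk i), fun α => ha _⟩⟩

end GrowthBound

section Density

theorem ae_eq_zero_of_forall_integral_cexp_mul_eq_zero {E : Type*} [NormedAddCommGroup E]
    [NormedSpace ℝ E] [CompleteSpace E] [SecondCountableTopology E] [MeasurableSpace E]
    [BorelSpace E] {μ : Measure E} {f : E → ℝ} (hf : Integrable f μ)
    (h0 : ∀ L : StrongDual ℝ E, ∫ x, Complex.exp (L x * Complex.I) * f x ∂μ = 0) :
    f =ᵐ[μ] 0 := by
  have hpos : AEMeasurable (fun x => ENNReal.ofReal (f x)) μ := hf.1.aemeasurable.ennreal_ofReal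
  have hneg : AEMeasurable (fun x => ENNReal.ofReal (-f x)) μ :=
    hf.1.aemeasurable.neg.ennreal_ofReal
  have hpos_finite := isFiniteMeasure_withDensity_ofReal hf.2
  have hneg_int : Integrable (fun x => -f x) μ := hf.neg
  have hneg_finite := isFiniteMeasure_withDensity_ofReal hneg_int.2
  have hint (L : StrongDual ℝ E) {g : E → ℝ} (hg : Integrable g μ) :
      Integrable (fun x => max (g x) 0 • Complex.exp (L x * Complex.I)) μ := by
    refine hg.pos_part.smul_bdd 1 (Continuous.aestronglyMeasurable (by fun_prop))
      (.of_forall fun x => ?_)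
    rw [Complex.norm_exp_ofReal_mul_I]
  have hparts : μ.withDensity (fun x => ENNReal.ofReal (f x))
      = μ.withDensity (fun x => ENNReal.ofReal (-f x)) := by
    refine Measure.ext_of_charFunDual (funext fun L => ?_)
    have hlt (g : E → ℝ) : ∀ᵐ x ∂μ, ENNReal.ofReal (g x) < ⊤ :=
      .of_forall fun _ => ENNReal.ofReal_lt_top
    rw [charFunDual_apply, charFunDual_apply,
      integral_withDensity_eq_integral_toReal_smul₀ hpos (hlt f),
      integral_withDensity_eq_integral_toReal_smul₀ hneg (hlt fun x => -f x)]
    simp only [ENNReal.toReal_ofReal']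
    rw [← sub_eq_zero, ← integral_sub (hint L hf) (hint L hneg_int), ← h0 L]
    refine integral_congr_ae (.of_forall fun x => ?_)
    simp only
    rw [← sub_smul, max_zero_sub_eq_self, Complex.real_smul, mul_comm]
  rw [withDensity_eq_iff hpos hneg hf.lintegral_lt_top.ne] at hparts
  filter_upwards [hparts] with x hx
  have hx' := congrArg ENNReal.toReal hx
  rwa [ENNReal.toReal_ofReal', ENNReal.toReal_ofReal', ← sub_eq_zero, max_zero_sub_eq_self] at hx'

theorem integral_cexp_mul_eq_zero_of_moments_eq_zero {X : Type*} [MeasurableSpace X]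
    {μ : Measure X} {y f : X → ℝ} (hy : AEStronglyMeasurable y μ) (hf : AEStronglyMeasurable f μ)
    (hint : Integrable (fun x => Real.exp |y x| * |f x|) μ)
    (h0 : ∀ n : ℕ, ∫ x, y x ^ n * f x ∂μ = 0) :
    ∫ x, Complex.exp (y x * Complex.I) * f x ∂μ = 0 := by
  have hexp_real (t : ℝ) : HasSum (fun n : ℕ => t ^ n / n.factorial) (Real.exp t) := by
    rw [Real.exp_eq_exp_ℝ]
    exact NormedSpace.expSeries_div_hasSum_exp t
  have hexp_complex (z : ℂ) : HasSum (fun n : ℕ => z ^ n / n.factorial) (Complex.exp z) := by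
    rw [Complex.exp_eq_exp_ℂ]
    exact NormedSpace.expSeries_div_hasSum_exp z
  have hbound (x : X) : HasSum (fun n : ℕ => |y x| ^ n / n.factorial * |f x|)
      (Real.exp |y x| * |f x|) := (hexp_real _).mul_right _
  have hsum : HasSum
      (fun n : ℕ => ∫ x, (y x * Complex.I) ^ n / n.factorial * (f x : ℂ) ∂μ)
      (∫ x, Complex.exp (y x * Complex.I) * f x ∂μ) := by
    refine hasSum_integral_of_dominated_convergence
      (fun n x => |y x| ^ n / n.factorial * |f x|) (fun n => ?_)
      (fun n => .of_forall fun x => by simp) (.of_forall fun x => (hbound x).summable)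
      (by simpa only [(hbound _).tsum_eq] using hint)
      (.of_forall fun x => (hexp_complex _).mul_right _)
    simp only [div_eq_mul_inv]
    exact (((Complex.continuous_ofReal.comp_aestronglyMeasurable hy).mul_const _).pow n
      |>.mul_const _).mul (Complex.continuous_ofReal.comp_aestronglyMeasurable hf)
  refine hsum.unique ?_
  convert hasSum_zero with n
  calc ∫ x, (y x * Complex.I) ^ n / n.factorial * (f x : ℂ) ∂μ
      = ∫ x, Complex.I ^ n / n.factorial * ((y x ^ n * f x : ℝ) : ℂ) ∂μ := by
        congr with x
        push_cast
        ring
    _ = 0 := by rw [integral_const_mul, integral_complex_ofReal, h0, Complex.ofReal_zero, mul_zero]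

variable {d : ℕ} {σ : Fin d → ℝ≥0}

theorem memLp_exp_abs_sum_diagGaussian (σ : Fin d → ℝ≥0) (c : Fin d → ℝ) :
    MemLp (fun x : Fin d → ℝ => Real.exp |∑ i, c i * x i|) 2 (diagGaussian σ) := by
  have hmeas : Measurable fun x : Fin d → ℝ => Real.exp |∑ i, c i * x i| :=
    Continuous.measurable (by fun_prop)
  rw [memLp_two_iff_integrable_sq hmeas.aestronglyMeasurable]
  have hexp (i : Fin d) : Integrable (fun x : ℝ => Real.exp (2 * |c i| * |x|))
      (gaussianReal 0 (σ i)) :=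
    integrable_exp_mul_abs (X := fun x => x) (integrable_exp_mul_gaussianReal _)
      (integrable_exp_mul_gaussianReal _)
  refine (Integrable.fintype_prod (f := fun i x => Real.exp (2 * |c i| * |x|)) hexp).mono'
    (hmeas.pow_const 2).aestronglyMeasurable (.of_forall fun x => ?_)
  rw [Real.norm_of_nonneg (by positivity), ← Real.exp_sum, ← Real.exp_nat_mul]
  gcongr
  calc (2 : ℕ) * |∑ i, c i * x i| ≤ (2 : ℕ) * ∑ i, |c i * x i| := by
        gcongr
        exact abs_sum_le_sum_abs _ _
    _ = ∑ i, 2 * |c i| * |x i| := by simp only [abs_mul, mul_sum, Nat.cast_ofNat, mul_assoc]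

theorem integral_sum_pow_mul_eq_zero {f : Lp ℝ 2 (diagGaussian σ)}
    (h0 : ∀ α, ⟪monomialLp σ α, f⟫_ℝ = 0) (c : Fin d → ℝ) (n : ℕ) :
    ∫ x, (∑ i, c i * x i) ^ n * f x ∂diagGaussian σ = 0 := by
  have hmonomial (α : Fin d → ℕ) :
      ∫ x, prodPoly (fun i => Polynomial.X ^ α i) x * f x ∂diagGaussian σ = 0 := by
    rw [← inner_toLp_eq_integral (memLp_prodPoly σ _)]
    exact h0 α
  have hexpand (x : Fin d → ℝ) : (∑ i, c i * x i) ^ n * f x = ∑ α ∈ piAntidiag univ n,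
      (Nat.multinomial univ α * ∏ i, c i ^ α i) *
        (prodPoly (fun i => Polynomial.X ^ α i) x * f x) := by
    simp only [sum_pow_eq_sum_piAntidiag, sum_mul, mul_pow, prod_mul_distrib, prodPoly,
      Polynomial.eval_pow, Polynomial.eval_X, mul_assoc]
  simp only [hexpand]
  rw [integral_finsetSum]
  · exact sum_eq_zero fun α _ => by rw [integral_const_mul, hmonomial, mul_zero]
  · exact fun α _ => ((memLp_prodPoly σ _).integrable_mul (Lp.memLp f)).const_mul _

theorem eq_zero_of_inner_monomialLp_eq_zero {f : Lp ℝ 2 (diagGaussian σ)}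
    (h0 : ∀ α, ⟪monomialLp σ α, f⟫_ℝ = 0) : f = 0 := by
  have hf := Lp.memLp f
  rw [Lp.eq_zero_iff_ae_eq_zero]
  refine ae_eq_zero_of_forall_integral_cexp_mul_eq_zero (hf.integrable one_le_two) fun L => ?_
  obtain ⟨c, hL⟩ : ∃ c : Fin d → ℝ, ∀ x, L x = ∑ i, c i * x i := by
    refine ⟨fun i => L (Pi.single i 1), fun x => ?_⟩
    conv_lhs => rw [pi_eq_sum_univ' x, map_sum]
    exact sum_congr rfl fun i _ => by rw [map_smul, smul_eq_mul, mul_comm]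
  refine integral_cexp_mul_eq_zero_of_moments_eq_zero L.continuous.aestronglyMeasurable hf.1 ?_ ?_
  · simp only [hL]
    exact (memLp_exp_abs_sum_diagGaussian σ c).integrable_mul hf.abs
  · simpa only [hL] using integral_sum_pow_mul_eq_zero h0 c

end Density

section OrthonormalFamilies

variable {H J : Type*} [NormedAddCommGroup H] [InnerProductSpace ℝ H] {v : J → H}

theorem countable_of_orthonormal [SecondCountableTopology H] (hv : Orthonormal ℝ v) :
    Countable J := by
  have hdist {i j : J} (hij : i ≠ j) : 1 ≤ dist (v i) (v j) := by
    have hsq : ‖v i - v j‖ ^ 2 = 2 := by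
      rw [norm_sub_sq_real, hv.1 i, hv.1 j, hv.2 hij]
      norm_num
    rw [dist_eq_norm]
    nlinarith [norm_nonneg (v i - v j)]
  rw [← Set.countable_univ_iff]
  refine Set.PairwiseDisjoint.countable_of_isOpen (s := fun j => Metric.ball (v j) (1 / 2))
    (fun i _ j _ hij => Metric.ball_disjoint_ball ?_) (fun _ _ => Metric.isOpen_ball)
    fun j _ => ⟨v j, Metric.mem_ball_self (by norm_num)⟩
  linarith [hdist hij]

theorem subsingleton_of_orthonormal_of_inner_eq_zero (hv : Orthonormal ℝ v) {m : H}
    (hm : ∀ f, ⟪m, f⟫_ℝ = 0 → f = 0) : Subsingleton J := by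
  refine ⟨fun i j => by_contra fun hij => ?_⟩
  have hcomb : ⟪m, v j⟫_ℝ • v i - ⟪m, v i⟫_ℝ • v j = 0 := by
    refine hm _ ?_
    rw [inner_sub_right, inner_smul_right, inner_smul_right]
    ring
  have hj : ⟪m, v j⟫_ℝ = 0 := by
    simpa [inner_sub_right, inner_smul_right, hv.2 hij, hv.1 i] using congrArg (⟪v i, ·⟫_ℝ) hcomb
  exact hv.ne_zero j (hm _ hj)

end OrthonormalFamilies

section EigenvalueBounds

variable {h : ℝ → ℝ} {a : ℕ → ℝ} {d : ℕ} {σ : Fin d → ℝ≥0}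

/-- All coefficients `a m` with `m ≤ n` of the same parity as `n` are positive: these are the
degrees on which the eigenvalue bounds of degree `n` rely. -/
def HasPosParityCoeffs (a : ℕ → ℝ) (n : ℕ) : Prop :=
  ∀ m ≤ n, m ≡ n [MOD 2] → 0 < a m

theorem HasPosParityCoeffs.exists_pos_le {n : ℕ} (ha : HasPosParityCoeffs a n) :
    ∃ δ > 0, ∀ m ≤ n, m ≡ n [MOD 2] → δ ≤ a m := by
  obtain ⟨m₀, hm₀, hmin⟩ := exists_min_image ((range (n + 1)).filter fun m => m ≡ n [MOD 2]) a
    ⟨n, by simp [Nat.ModEq.refl]⟩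
  simp only [mem_filter, mem_range, Nat.lt_succ_iff] at hm₀ hmin
  exact ⟨a m₀, ha m₀ hm₀.1 hm₀.2, fun m hm hmn => hmin m ⟨hm, hmn⟩⟩

theorem frequently_not_hasPosParityCoeffs {n : ℕ} (hn : ¬ HasPosParityCoeffs a n) :
    ∃ᶠ m in atTop, ¬ HasPosParityCoeffs a m := by
  refine frequently_atTop.2 fun N => ⟨n + 2 * N, by lia, fun hpos => hn fun m hm hmn => ?_⟩
  exact hpos m (by lia) (hmn.trans (by simp [Nat.ModEq]))

theorem exists_isFormComparable (hh : IsNonnegSeries h a) (τ : ℝ) :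
    ∃ K L : ℕ → ℝ, ∀ {d : ℕ} {σ : Fin d → ℝ≥0}, (∀ i, 0 < σ i) → ∑ i, (σ i : ℝ) ≤ τ →
      ∀ (hk : IsHilbertSchmidtKernel (innerProductKernel h d) (diagGaussian σ)) (n : ℕ),
        HasPosParityCoeffs a n → IsFormComparable hk.toCLM (hermiteLp σ)
          (fun β => ∏ i, (σ i : ℝ) ^ β i) {β | ∑ i, β i = n} (K n) (L n) := by
  obtain ⟨M, r, hM, hr, hgrowth⟩ := exists_growth_bound hh τ
  choose! δ hδ hδa using fun n => HasPosParityCoeffs.exists_pos_le (a := a) (n := n)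
  refine ⟨fun n => M * r ^ n * (Real.exp (25 * r * τ) * (5 ^ n * Real.exp (25 * r * τ))),
    fun n => Real.exp ((∑ j ∈ range n, τ ^ j) * τ) *
      (2 ^ n * (δ n)⁻¹ * Real.exp ((∑ j ∈ range n, τ ^ j) * τ)), fun hσ hτ hk n hn => ?_⟩
  obtain ⟨hrσ, haM⟩ := hgrowth hσ hτ hk
  have hδn := hδ n hn
  refine ⟨by positivity, by positivity, fun B x hB => ?_, fun B f hB => ?_⟩
  · exact hasSum_le_of_sum_le (hasSum_kernelCoeff_mul_inner_sq hh hk _) fun I =>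
      sum_kernelCoeff_mul_inner_sum_sq_le hσ hτ hh.nonneg hM hr hrσ haM (fun β hβ => hB hβ) I x
  · refine (sum_prod_pow_mul_inner_hermiteLp_sq_le hσ hτ hδn hh.nonneg (hδa n hn)
      (fun β hβ => hB hβ) f).trans (mul_le_mul_of_nonneg_left ?_ (by positivity))
    exact sum_le_hasSum _ (fun α _ => mul_nonneg (kernelCoeff_nonneg hh.nonneg α) (sq_nonneg _))
      (hasSum_kernelCoeff_mul_inner_sq hh hk f)

section Eigenvectors

variable {J : Type*} {lam : J → ℝ}

theorem inner_apply_self_of_orthonormal {H : Type*} [NormedAddCommGroup H]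
    [InnerProductSpace ℝ H] {T : H →L[ℝ] H} {e : J → H} (he : Orthonormal ℝ e)
    (hlam : ∀ j, T (e j) = lam j • e j) (j : J) : ⟪T (e j), e j⟫_ℝ = lam j := by
  simp [hlam, inner_smul_left, he.1 j]

theorem eigenvalue_innerProductKernel_pos (hh : IsNonnegSeries h a) (ha : ∀ m, 0 < a m)
    (hk : IsHilbertSchmidtKernel (innerProductKernel h d) (diagGaussian σ))
    {e : J → Lp ℝ 2 (diagGaussian σ)} (he : Orthonormal ℝ e)
    (hlam : ∀ j, hk.toCLM (e j) = lam j • e j) (j : J) : 0 < lam j := by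
  have hform := inner_apply_self_of_orthonormal he hlam j
  refine (hform ▸ inner_toCLM_innerProductKernel_nonneg hh hk (e j)).lt_of_ne fun hzero => ?_
  refine he.ne_zero j (eq_zero_of_inner_monomialLp_eq_zero fun α => ?_)
  have hle := kernelCoeff_mul_inner_sq_le_inner_toCLM hh hk (e j) α
  rw [hform, ← hzero] at hle
  have hcoeff : 0 < kernelCoeff a α :=
    mul_pos (ha _) (Nat.cast_pos.2 (Nat.multinomial_pos univ α))
  exact sq_eq_zero_iff.1 ((nonpos_of_mul_nonpos_right hle hcoeff).antisymm (sq_nonneg _))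

theorem subsingleton_of_orthonormal_diagGaussian_fin_zero {σ : Fin 0 → ℝ≥0}
    {e : J → Lp ℝ 2 (diagGaussian σ)} (he : Orthonormal ℝ e) : Subsingleton J :=
  subsingleton_of_orthonormal_of_inner_eq_zero he (m := monomialLp σ 0) fun _ hf =>
    eq_zero_of_inner_monomialLp_eq_zero fun α => by rwa [Subsingleton.elim α 0]

theorem exists_bijective_eigenvalue_comparable (hh : IsNonnegSeries h a) (hσ : ∀ i, 0 < σ i)
    (hk : IsHilbertSchmidtKernel (innerProductKernel h d) (diagGaussian σ)) {K L θ : ℕ → ℝ}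
    (hform : ∀ n, HasPosParityCoeffs a n → IsFormComparable hk.toCLM (hermiteLp σ)
      (fun β => ∏ i, (σ i : ℝ) ^ β i) {β | ∑ i, β i = n} (K n) (L n)) (hθ : ∀ n, 0 < θ n)
    (hθKL : ∀ n, 6 * θ n * (2 * K n + L n) ≤ ((1 / 2) ^ (2 * n + 2)) ^ 2)
    (hθn : ∀ n, θ n ≤ (n.factorial : ℝ)⁻¹)
    {e : HilbertBasis J ℝ (Lp ℝ 2 (diagGaussian σ))} (hlam : ∀ j, hk.toCLM (e j) = lam j • e j) :
    ∃ φ : (Fin d → ℕ) → J, Function.Bijective φ ∧ ∀ β, HasPosParityCoeffs a (∑ i, β i) →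
      IsComparable (θ (∑ i, β i)) (∏ i, (σ i : ℝ) ^ β i) (lam (φ β)) := by
  have hnonneg (j : J) : 0 ≤ lam j := by
    rw [← inner_apply_self_of_orthonormal e.orthonormal hlam j]
    exact inner_toCLM_innerProductKernel_nonneg hh hk _
  obtain ⟨f, hf, hfcomp⟩ := exists_injective_eigenvalue_comparable hlam hnonneg
    (fun c hc => by
      simpa only [Real.norm_of_nonneg (hnonneg _)] using finite_setOf_le_norm_eigenvalue
        (isCompactOperator_toCLM_innerProductKernel hh hk) e.orthonormal hlam hc)
    (orthonormal_hermiteLp hσ) (fun β => prod_pos fun i _ => pow_pos (hσ i) _)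
    (fun β => ∑ i, β i) hθ hθKL hform
  have : Fact ((2 : ℝ≥0∞) ≠ ⊤) := ⟨ENNReal.ofNat_ne_top⟩
  have hJ : Countable J := countable_of_orthonormal e.orthonormal
  obtain ⟨g, hg, hgcomp⟩ : ∃ g : J → Fin d → ℕ, Function.Injective g ∧
      ∀ j, HasPosParityCoeffs a (∑ i, g j i) →
        IsComparable (θ (∑ i, g j i)) (∏ i, (σ i : ℝ) ^ g j i) (lam j) := by
    rcases d.eq_zero_or_pos with rfl | hd
    · have := subsingleton_of_orthonormal_diagGaussian_fin_zero e.orthonormal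
      exact ⟨fun _ => 0, Function.injective_of_subsingleton _, fun j hj =>
        Subsingleton.elim (f 0) j ▸ hfcomp 0 hj⟩
    · have : Nonempty (Fin d) := ⟨⟨0, hd⟩⟩
      refine exists_injective_multiIndex_comparable hσ ?_ hθn
      by_cases hall : ∀ n, HasPosParityCoeffs a n
      · exact .inr (eigenvalue_innerProductKernel_pos hh (fun m => hall m m le_rfl rfl) hk
          e.orthonormal hlam)
      · exact .inl (frequently_not_hasPosParityCoeffs (not_forall.1 hall).choose_spec)
  exact Function.Embedding.schroeder_bernstein_of_rel hf hg
    (fun β j => HasPosParityCoeffs a (∑ i, β i) →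
      IsComparable (θ (∑ i, β i)) (∏ i, (σ i : ℝ) ^ β i) (lam j)) hfcomp hgcomp

end Eigenvectors

theorem exists_pos_mul_le_and_le {c b : ℝ} (hc : 0 < c) (hb : 0 < b) (x : ℝ) :
    ∃ θ > 0, θ * x ≤ c ∧ θ ≤ b := by
  refine ⟨min b (c / (|x| + 1)), by positivity, ?_, min_le_left _ _⟩
  calc min b (c / (|x| + 1)) * x ≤ min b (c / (|x| + 1)) * (|x| + 1) := by
        gcongr
        linarith [le_abs_self x]
    _ ≤ c / (|x| + 1) * (|x| + 1) := by
        gcongr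
        exact min_le_right _ _
    _ = c := div_mul_cancel₀ _ (by positivity)

end EigenvalueBounds

theorem mainTheorem2 (h : ℝ → ℝ) (a : ℕ → ℝ) (hh : IsNonnegSeries h a) (τ : ℝ) :
    ∃ C₁ C₂ : ℕ → ℝ, (∀ n, 0 < C₁ n) ∧ (∀ n, 0 < C₂ n) ∧
      ∀ (d : ℕ) (σ : Fin d → ℝ≥0), (∀ i, 0 < σ i) → ∑ i, (σ i : ℝ) ≤ τ →
        IsHilbertSchmidtKernel (innerProductKernel h d) (diagGaussian σ) →
        ∃ (e : HilbertBasis (Fin d → ℕ) ℝ (Lp ℝ 2 (diagGaussian σ)))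
          (lam : (Fin d → ℕ) → ℝ),
          IsEigenbasis (innerProductKernel h d) (diagGaussian σ) e lam ∧
          ∀ β : Fin d → ℕ,
            (∀ m ≤ ∑ i, β i, m ≡ ∑ i, β i [MOD 2] → 0 < a m) →
            C₁ (∑ i, β i) * ∏ i, (σ i : ℝ) ^ β i ≤ lam β ∧
              lam β ≤ C₂ (∑ i, β i) * ∏ i, (σ i : ℝ) ^ β i := by
  obtain ⟨K, L, hform⟩ := exists_isFormComparable hh τ
  choose θ hθ hθKL hθn using fun n : ℕ => exists_pos_mul_le_and_le
    (c := ((1 / 2) ^ (2 * n + 2)) ^ 2) (b := (n.factorial : ℝ)⁻¹) (by positivity) (by positivity)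
    (6 * (2 * K n + L n))
  refine ⟨θ, fun n => (θ n)⁻¹, hθ, fun n => inv_pos.2 (hθ n), fun d σ hσ hτ hk => ?_⟩
  obtain ⟨J, e, lam, hlam⟩ := exists_hilbertBasis_eigenvectors
    (isCompactOperator_toCLM_innerProductKernel hh hk) (isSymmetric_toCLM_innerProductKernel hh hk)
  obtain ⟨φ, hφ, hcomp⟩ := exists_bijective_eigenvalue_comparable hh hσ hk (hform hσ hτ hk) hθ
    (fun n => by linarith [hθKL n]) hθn hlam
  obtain ⟨e', he'⟩ := exists_reindex_hilbertBasis e hφ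
  refine ⟨e', fun β => lam (φ β), fun β => ?_, fun β hβ => ⟨(hcomp β hβ).1, ?_⟩⟩
  · refine (hk.coeFn_toCLM (e' β)).symm.trans ?_
    rw [he', hlam]
    exact Lp.coeFn_smul _ _
  · exact (le_inv_mul_iff₀ (hθ _)).2 (hcomp β hβ).2
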